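/- Let $(R,\mathfrak m)$ be a commutative Noetherian local ring that is a hypersurface, i.e. its $\mathfrak m$-adic completion is isomorphic to $Q/(f)$ for some regular local ring $Q$ and some nonzero element $f$ of the maximal ideal of $Q$. Assume that $R$ has an isolated singularity, i.e. $R_{\mathfrak p}$ is a regular local ring for every prime ideal $\mathfrak p\neq\mathfrak m$ of $R$. Let $M$ and $N$ be finitely generated $R$-modules that are maximal Cohen-Macaulay, i.e. $\operatorname{depth}_R M=\operatorname{depth}_R N=\dim R$, and suppose that neither $M$ nor $N$ is free. Assume that $M$ is Tor-rigid, i.e. for every finitely generated $R$-module $X$ and every integer $n\ge 0$, if $\operatorname{Tor}_n^R(M,X)=0$ then $\operatorname{Tor}_i^R(M,X)=0$ for all $i\ge n$. Then $\operatorname{depth}_R(M\otimes_R N)=0$. (Here the depth of a nonzero finitely generated module is the maximal length of a regular sequence on it in $\mathfrak m$, and $\operatorname{depth}(0)=\infty$.) -/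

import Mathlib

open scoped TensorProduct

universe u

/-- The depth of a module over a local ring: the supremum of the lengths of (weakly) regular
sequences in the maximal ideal. For a nonzero finitely generated module over a Noetherian local
ring weakly regular sequences in the maximal ideal are regular, by Nakayama's lemma; for the zero
module every sequence is weakly regular, and the depth is `⊤`. -/
noncomputable def moduleDepth (R : Type*) [CommRing R] [IsLocalRing R]
    (M : Type*) [AddCommGroup M] [Module R M] : ℕ∞ :=
  ⨆ (rs : List R) (_ : ∀ r ∈ rs, r ∈ IsLocalRing.maximalIdeal R)
    (_ : RingTheory.Sequence.IsWeaklyRegular M rs), (rs.length : ℕ∞)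

/-- A finitely generated module over a local ring `R` is maximal Cohen-Macaulay if its depth is
the Krull dimension of `R`. -/
structure IsMaximalCohenMacaulay (R : Type*) [CommRing R] [IsLocalRing R]
    (M : Type*) [AddCommGroup M] [Module R M] : Prop where
  finite : Module.Finite R M
  depth_eq : (moduleDepth R M : WithBot ℕ∞) = ringKrullDim R

/-- A Noetherian local ring `R` is a hypersurface if its completion is isomorphic to `Q / (f)` for
a regular local ring `Q` and a nonzero (equivalently, `Q`-regular) element `f` of the maximal
ideal of `Q`. -/
def IsHypersurface (R : Type u) [CommRing R] [IsLocalRing R] : Prop :=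
  ∃ (Q : Type u) (_ : CommRing Q) (_ : IsRegularLocalRing Q) (f : Q),
    f ≠ 0 ∧ f ∈ IsLocalRing.maximalIdeal Q ∧
    Nonempty (AdicCompletion (IsLocalRing.maximalIdeal R) R ≃+* Q ⧸ Ideal.span {f})

/-- A local ring has an isolated singularity if its localizations at all nonmaximal primes are
regular. -/
def HasIsolatedSingularity (R : Type*) [CommRing R] [IsLocalRing R] : Prop :=
  ∀ (p : Ideal R) [p.IsPrime], p ≠ IsLocalRing.maximalIdeal R →
    IsRegularLocalRing (Localization.AtPrime p)

/-- `M` is Tor-rigid if, for every finitely generated module `X` and every `n ≥ 0`, the vanishing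
of `Tor_n(M, X)` implies the vanishing of `Tor_i(M, X)` for all `i ≥ n`. -/
def IsTorRigid (R : Type u) [CommRing R] (M : Type u) [AddCommGroup M] [Module R M] : Prop :=
  ∀ (X : Type u) [AddCommGroup X] [Module R X] [Module.Finite R X] (n : ℕ),
    CategoryTheory.Limits.IsZero
      (((CategoryTheory.Tor (ModuleCat.{u} R) n).obj (ModuleCat.of R M)).obj
        (ModuleCat.of R X)) →
    ∀ i : ℕ, n ≤ i → CategoryTheory.Limits.IsZero
      (((CategoryTheory.Tor (ModuleCat.{u} R) i).obj (ModuleCat.of R M)).obj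
        (ModuleCat.of R X))

/-!
A regular element on `M ⊗ N` would force `Tor` of `M` with a cosyzygy `C` of `N` to vanish, and over
a hypersurface such vanishing makes one of the two modules free.

By duality over the Gorenstein ring `R`, the maximal Cohen-Macaulay module `N` embeds in a finite
free module `F` with maximal Cohen-Macaulay cokernel `C`
(`IsCohenMacaulayAlmostRegular.exists_embedding`). Iterating, `C` is a syzygy of every order, and
therefore free at each prime `p ≠ 𝔪`, where `R` is regular (`IsSyzygy.free_of_isRegularLocalRing`).
So `N → F` has a retraction up to a scalar outside `p`, and the kernel of `M ⊗ N → M ⊗ F` is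
`𝔪`-power torsion. If `M ⊗ N` has positive depth this kernel is zero
(`lTensor_injective_of_isSMulRegular`), which means `Tor₁(M, C) = 0`; by rigidity `Tor_i(M, C) = 0`
for all `i ≥ 1`.

It remains that maximal Cohen-Macaulay modules `M`, `C` with vanishing `Tor` over a hypersurface
cannot both be nonfree (`IsCohenMacaulayAlmostRegular.free_or_free`); if `C` is free, the sequence
`0 → N → F → C → 0` splits and `N` is free as well. The proof is by induction on `d = dim R`,
dividing by an element regular on `R`, `M` and the modules involved, at the cost of one `Tor` group.
In dimension zero `R` is a quotient of a discrete valuation ring, and nonfree modules have cyclic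
summands `R / t ^ b` and `R / t ^ c`, whose first `Tor` is nonzero.

To make the induction work without completions, the hypersurface hypothesis is replaced by one that
it implies: `R` is Cohen-Macaulay with embedding dimension at most `d + 1`
(`IsCohenMacaulayAlmostRegular`). This passes to the quotient by a regular element outside `𝔪 ^ 2`,
and for `d = 0` it says that `𝔪` is principal. Reduction to dimension zero, where `R` is
self-injective, also gives the duality (`IsCohenMacaulayAlmostRegular.exists_extension`).
-/

open IsLocalRing RingTheory.Sequence CategoryTheory Function
open scoped Pointwise

/-! ### Depth -/

/-- The depth of `M` is at least `n`: there is a weakly regular sequence of length `n` on `M` in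
the maximal ideal. The zero module satisfies this for every `n`. -/
def HasDepthGE (R : Type*) [CommRing R] [IsLocalRing R] (M : Type*) [AddCommGroup M] [Module R M]
    (n : ℕ) : Prop :=
  ∃ rs : List R, rs.length = n ∧ (∀ r ∈ rs, r ∈ maximalIdeal R) ∧ IsWeaklyRegular M rs

namespace HasDepthGE

section basic

variable {R : Type*} [CommRing R] [IsLocalRing R] {M : Type*} [AddCommGroup M] [Module R M]

lemma zero : HasDepthGE R M 0 := ⟨[], rfl, by simp, .nil R M⟩

lemma congr {M' : Type*} [AddCommGroup M'] [Module R M'] (e : M ≃ₗ[R] M') {n : ℕ}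
    (h : HasDepthGE R M n) : HasDepthGE R M' n := by
  obtain ⟨rs, h1, h2, h3⟩ := h
  exact ⟨rs, h1, h2, (e.isWeaklyRegular_congr rs).mp h3⟩

lemma exists_cons {n : ℕ} (h : HasDepthGE R M (n + 1)) :
    ∃ x ∈ maximalIdeal R, IsSMulRegular M x ∧ HasDepthGE R (QuotSMulTop x M) n := by
  obtain ⟨rs, h1, h2, h3⟩ := h
  match rs, h1, h2, h3 with
  | a :: l, h1, h2, h3 =>
    rw [isWeaklyRegular_cons_iff] at h3
    exact ⟨a, h2 a (by simp), h3.1, l, by simpa using h1, fun r hr ↦ h2 r (by simp [hr]), h3.2⟩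

lemma of_quotSMulTop {n : ℕ} {x : R} (hx : x ∈ maximalIdeal R) (hreg : IsSMulRegular M x)
    (h : HasDepthGE R (QuotSMulTop x M) n) : HasDepthGE R M (n + 1) := by
  obtain ⟨rs, h1, h2, h3⟩ := h
  exact ⟨x :: rs, by simp [h1], List.forall_mem_cons.mpr ⟨hx, h2⟩, .cons hreg h3⟩

lemma one_of_succ {n : ℕ}
    (h : HasDepthGE R M (n + 1)) : HasDepthGE R M 1 := by
  obtain ⟨x, hx, hreg, -⟩ := h.exists_cons
  exact .of_quotSMulTop hx hreg .zero

/-- Depth does not change when the ring is replaced by a quotient that acts on the module. -/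
lemma quotient_iff {I : Ideal R} [IsLocalRing (R ⧸ I)] [Module (R ⧸ I) M]
    [IsScalarTower R (R ⧸ I) M] {n : ℕ} : HasDepthGE (R ⧸ I) M n ↔ HasDepthGE R M n := by
  have hmk : ∀ r : R, Ideal.Quotient.mk I r ∈ maximalIdeal (R ⧸ I) ↔ r ∈ maximalIdeal R := by
    intro r
    have : IsLocalHom (Ideal.Quotient.mk I) :=
      IsLocalHom.of_surjective _ Ideal.Quotient.mk_surjective
    simp [mem_maximalIdeal, mem_nonunits_iff]
  constructor
  · rintro ⟨rs, h1, h2, h3⟩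
    obtain ⟨l, rfl⟩ := (List.map_surjective_iff.mpr
      (Ideal.Quotient.mk_surjective (I := I))) rs
    refine ⟨l, by simpa using h1, fun r hr ↦ (hmk r).mp (h2 _ (List.mem_map_of_mem hr)), ?_⟩
    exact (isWeaklyRegular_map_algebraMap_iff (R := R) (S := R ⧸ I) M l).mp h3
  · rintro ⟨l, h1, h2, h3⟩
    refine ⟨l.map (algebraMap R (R ⧸ I)), by simpa using h1, ?_,
      (isWeaklyRegular_map_algebraMap_iff (R := R) (S := R ⧸ I) M l).mpr h3⟩
    intro r hr
    obtain ⟨a, ha, rfl⟩ := List.mem_map.mp hr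
    exact (hmk a).mpr (h2 a ha)

end basic

section noetherian

variable {R : Type u} [CommRing R] [IsLocalRing R] [IsNoetherianRing R]

/-- A quotient by a regular element lowers depth by at most one; via the vanishing of
`Ext` from the residue field, which Rees' theorem identifies with depth. -/
lemma quotSMulTop {M : Type u} [AddCommGroup M] [Module R M] [Module.Finite R M] {n : ℕ}
    (h : HasDepthGE R M (n + 1)) {x : R} (hx : x ∈ maximalIdeal R) (hreg : IsSMulRegular M x) :
    HasDepthGE R (QuotSMulTop x M) n := by
  cases subsingleton_or_nontrivial M with
  | inl _ =>
    refine ⟨List.replicate n 0, by simp, fun r hr ↦ ?_, ?_⟩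
    · rw [List.eq_of_mem_replicate hr]; exact zero_mem _
    · refine ⟨fun i hi ↦ ?_⟩
      exact fun a b _ ↦ Subsingleton.elim _ _
  | inr _ =>
    have key : ∀ (P : Type u) [AddCommGroup P] [Module R P] [Module.Finite R P] [Nontrivial P],
        (maximalIdeal R) • (⊤ : Submodule R P) < ⊤ := fun P _ _ _ _ ↦
      (Submodule.top_ne_ideal_smul_of_le_jacobson_annihilator
        (maximalIdeal_le_jacobson _)).symm.lt_top
    have : Nontrivial (QuotSMulTop x M) := nontrivial_quotSMulTop_of_mem_maximalIdeal M hx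
    obtain ⟨rs, h1, h2, h3⟩ := h
    have hE := ((ModuleCat.exists_isRegular_tfae (maximalIdeal R) (n + 1) (ModuleCat.of R M)
      (key M)).out 3 1 :
        (∃ rs : List R, rs.length = n + 1 ∧ (∀ r ∈ rs, r ∈ maximalIdeal R) ∧ IsRegular M rs) ↔ _).mp
        ⟨rs, h1, h2, IsRegular.of_isWeaklyRegular_of_mem_maximalIdeal M h2 h3⟩
    have hE' : ∀ i < n, Subsingleton (Abelian.Ext
        (ModuleCat.of R (Shrink.{u} (R ⧸ maximalIdeal R)))
        (ModuleCat.of R (QuotSMulTop x M)) i) := by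
      intro i hi
      have zero1 := AddCommGrpCat.isZero_of_iff_subsingleton.mpr (hE i (by lia))
      have zero2 := AddCommGrpCat.isZero_of_iff_subsingleton.mpr (hE (i + 1) (by lia))
      have hreg' : IsSMulRegular (ModuleCat.of R M) x := hreg
      exact AddCommGrpCat.subsingleton_of_isZero <| ShortComplex.Exact.isZero_of_both_zeros
        ((Abelian.Ext.covariant_sequence_exact₃' _ hreg'.smulShortComplex_shortExact) i (i + 1)
          rfl) (zero1.eq_zero_of_src _) (zero2.eq_zero_of_tgt _)
    obtain ⟨rs, h1, h2, h3⟩ := ((ModuleCat.exists_isRegular_tfae (maximalIdeal R) n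
      (ModuleCat.of R (QuotSMulTop x M)) (key _)).out 1 3).mp hE'
    exact ⟨rs, h1, h2, h3.1⟩

lemma not_maximalIdeal_le {M : Type*} [AddCommGroup M] [Module R M]
    (h : HasDepthGE R M 1) {P : Ideal R} (hP : P ∈ associatedPrimes R M) :
    ¬ maximalIdeal R ≤ P := by
  intro hle
  obtain ⟨x, hx, hreg, -⟩ := h.exists_cons
  have : x ∈ ⋃ p ∈ associatedPrimes R M, (p : Set R) := Set.mem_biUnion hP (hle hx)
  rw [biUnion_associatedPrimes_eq_compl_regular] at this
  exact this hreg

/-- Prime avoidance: a common regular element that is a minimal generator of the maximal ideal. -/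
lemma exists_isSMulRegular_notMem_sq {A B C : Type u} [AddCommGroup A] [Module R A]
    [Module.Finite R A] [AddCommGroup B] [Module R B] [Module.Finite R B] [AddCommGroup C]
    [Module R C] [Module.Finite R C] (hA : HasDepthGE R A 1) (hB : HasDepthGE R B 1)
    (hC : HasDepthGE R C 1) (hm : ¬ maximalIdeal R ≤ maximalIdeal R ^ 2) :
    ∃ x ∈ maximalIdeal R, x ∉ maximalIdeal R ^ 2 ∧ IsSMulRegular A x ∧ IsSMulRegular B x ∧
      IsSMulRegular C x := by
  let s : Set (Ideal R) := {maximalIdeal R ^ 2} ∪ (associatedPrimes R A ∪ associatedPrimes R B ∪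
    associatedPrimes R C)
  have hs : s.Finite := (Set.finite_singleton _).union
    (((associatedPrimes.finite R A).union (associatedPrimes.finite R B)).union
      (associatedPrimes.finite R C))
  have hav := (Ideal.subset_union_prime_finite hs (f := id) (maximalIdeal R ^ 2)
    (maximalIdeal R ^ 2) (I := maximalIdeal R) (by
      rintro i (hi | (hi | hi) | hi) h1 -
      · exact absurd hi h1
      · exact hi.1
      · exact hi.1
      · exact hi.1)).not.mpr (by
      rintro ⟨i, (hi | (hi | hi) | hi), hle⟩
      · rw [Set.mem_singleton_iff] at hi
        subst hi; exact hm hle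
      · exact hA.not_maximalIdeal_le hi hle
      · exact hB.not_maximalIdeal_le hi hle
      · exact hC.not_maximalIdeal_le hi hle)
  obtain ⟨x, hx, hxn⟩ := Set.not_subset.mp hav
  have hreg : ∀ (D : Type u) [AddCommGroup D] [Module R D], associatedPrimes R D ⊆ s →
      IsSMulRegular D x := by
    intro D _ _ hD
    by_contra hc
    have : x ∈ ⋃ p ∈ associatedPrimes R D, (p : Set R) := by
      rw [biUnion_associatedPrimes_eq_compl_regular]; exact hc
    simp only [Set.mem_iUnion] at this hxn
    obtain ⟨p, hp, hxp⟩ := this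
    exact hxn ⟨p, hD hp, hxp⟩
  refine ⟨x, hx, fun h2 ↦ hxn (Set.mem_biUnion (Or.inl rfl) h2), hreg A fun p hp ↦ ?_,
    hreg B fun p hp ↦ ?_, hreg C fun p hp ↦ ?_⟩
  · exact Or.inr (Or.inl (Or.inl hp))
  · exact Or.inr (Or.inl (Or.inr hp))
  · exact Or.inr (Or.inr hp)

end noetherian

end HasDepthGE

lemma maximalIdeal_not_le_sq {R : Type*} [CommRing R] [IsLocalRing R] [IsNoetherianRing R]
    (h : maximalIdeal R ≠ ⊥) : ¬ maximalIdeal R ≤ maximalIdeal R ^ 2 := by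
  intro hle
  refine h (Submodule.eq_bot_of_le_smul_of_le_jacobson_bot (maximalIdeal R) (maximalIdeal R)
    (IsNoetherian.noetherian _) ?_ (maximalIdeal_le_jacobson _))
  rwa [smul_eq_mul, ← sq]

lemma maximalIdeal_ne_bot_of_isSMulRegular {R : Type*} [CommRing R] [IsLocalRing R] {x : R}
    (hx : x ∈ maximalIdeal R) (h : IsSMulRegular R x) : maximalIdeal R ≠ ⊥ := by
  intro hb
  rw [hb, Ideal.mem_bot] at hx
  subst hx
  exact zero_ne_one (h (show (0 : R) • (0 : R) = (0 : R) • 1 by simp))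

/-- A quotient of a local ring by an element of the maximal ideal is local. -/
lemma isLocalRing_quotient_span {R : Type*} [CommRing R] [IsLocalRing R] {x : R}
    (hx : x ∈ maximalIdeal R) : IsLocalRing (R ⧸ Ideal.span {x}) := by
  have : Nontrivial (R ⧸ Ideal.span {x}) := by
    rw [Ideal.Quotient.nontrivial_iff]
    exact ne_top_of_le_ne_top (maximalIdeal.isMaximal R).ne_top
      ((Ideal.span_singleton_le_iff_mem _).mpr hx)
  exact IsLocalRing.of_surjective' _ Ideal.Quotient.mk_surjective

/-- `R / x` as an ideal quotient and as a module quotient. -/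
noncomputable def quotSMulTopSelfEquiv {R : Type*} [CommRing R] (x : R) :
    QuotSMulTop x R ≃ₗ[R] R ⧸ Ideal.span {x} :=
  Submodule.quotEquivOfEq _ _ (by
    simp [← Submodule.ideal_span_singleton_smul])

/-! ### Embedding dimension and regular local rings -/

lemma map_mk_maximalIdeal {R : Type*} [CommRing R] [IsLocalRing R] (I : Ideal R)
    [IsLocalRing (R ⧸ I)] :
    (maximalIdeal R).map (Ideal.Quotient.mk I) = maximalIdeal (R ⧸ I) := by
  have hloc : IsLocalHom (Ideal.Quotient.mk I) :=
    IsLocalHom.of_surjective _ Ideal.Quotient.mk_surjective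
  have := ((IsLocalRing.local_hom_TFAE (Ideal.Quotient.mk I)).out 0 4).mp hloc
  rw [← this, Ideal.map_comap_of_surjective _ Ideal.Quotient.mk_surjective]

/-- Dividing by a minimal generator of the maximal ideal lowers the embedding dimension. -/
lemma spanFinrank_maximalIdeal_quotient_add_one_le {R : Type*} [CommRing R] [IsLocalRing R]
    [IsNoetherianRing R] {x : R} (hx : x ∈ maximalIdeal R) (hx2 : x ∉ maximalIdeal R ^ 2)
    [IsLocalRing (R ⧸ Ideal.span {x})] :
    (maximalIdeal (R ⧸ Ideal.span {x})).spanFinrank + 1 ≤ (maximalIdeal R).spanFinrank := by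
  classical
  obtain ⟨s, hcard, hspan⟩ := Submodule.FG.exists_span_finset_card_eq_spanFinrank
    (IsNoetherian.noetherian (maximalIdeal R))
  have hx' : x ∈ Submodule.span R (s : Set R) := by rw [hspan]; exact hx
  obtain ⟨a, ha⟩ := Submodule.mem_span_finset'.mp hx'
  have hmem : ∀ z ∈ s, z ∈ maximalIdeal R := fun z hz ↦ by
    rw [← hspan]; exact Submodule.subset_span hz
  -- some coefficient of `x` is a unit, as `x` is not in the square of the maximal ideal
  obtain ⟨z, hz⟩ : ∃ z, IsUnit (a z) := by
    by_contra! hc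
    refine hx2 ?_
    rw [← ha]
    refine sum_mem fun z _ ↦ ?_
    rw [sq, smul_eq_mul]
    exact Ideal.mul_mem_mul ((mem_maximalIdeal _).mpr (hc z)) (hmem z z.2)
  have hle : maximalIdeal (R ⧸ Ideal.span {x}) ≤
      Ideal.span ((s.erase z).image (Ideal.Quotient.mk (Ideal.span {x})) :
        Set (R ⧸ Ideal.span {x})) := by
    rw [← map_mk_maximalIdeal, ← hspan]
    change Ideal.map _ (Ideal.span _) ≤ _
    rw [Ideal.map_span, Ideal.span_le]
    rintro _ ⟨y, hy, rfl⟩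
    have herase : ∀ y ∈ s.erase (z : R), Ideal.Quotient.mk (Ideal.span {x}) y ∈
        Ideal.span ((s.erase z).image (Ideal.Quotient.mk (Ideal.span {x})) :
        Set (R ⧸ Ideal.span {x})) := fun y hy ↦
      Submodule.subset_span (by
        simp only [Finset.coe_image]; exact ⟨y, hy, rfl⟩)
    by_cases hyz : y = z
    · subst hyz
      have h1 : a z • (z : R) = x - ∑ w ∈ Finset.univ.erase z, a w • (w : R) := by
        rw [← ha, ← Finset.add_sum_erase _ _ (Finset.mem_univ z)]; ring
      have h2 : Ideal.Quotient.mk (Ideal.span {x}) (a z • (z : R)) ∈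
          Ideal.span ((s.erase z).image (Ideal.Quotient.mk (Ideal.span {x})) :
          Set (R ⧸ Ideal.span {x})) := by
        rw [h1, map_sub, map_sum, Ideal.Quotient.eq_zero_iff_mem.mpr
          (Ideal.mem_span_singleton_self x), zero_sub]
        refine neg_mem (sum_mem fun w hw ↦ ?_)
        rw [smul_eq_mul, map_mul]
        refine Submodule.smul_mem _ _ (herase w ?_)
        rw [Finset.mem_erase] at hw ⊢
        exact ⟨fun h ↦ hw.1 (Subtype.ext h), w.2⟩
      rw [smul_eq_mul, map_mul] at h2
      exact (Ideal.unit_mul_mem_iff_mem _ (hz.map _)).mp h2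
    · exact herase y (Finset.mem_erase.mpr ⟨hyz, hy⟩)
  have heq := le_antisymm hle (Submodule.span_le.mpr (by
    intro y hy
    simp only [Finset.coe_image] at hy
    obtain ⟨w, hw, rfl⟩ := hy
    rw [← map_mk_maximalIdeal]
    exact Ideal.mem_map_of_mem _ (hmem w (Finset.mem_of_mem_erase hw))))
  have hle2 := Submodule.spanFinrank_span_le_ncard_of_finite (R := R ⧸ Ideal.span {x})
    (((s.erase z).image (Ideal.Quotient.mk (Ideal.span {x})))).finite_toSet
  change (Ideal.span _).spanFinrank ≤ _ at hle2
  rw [← heq, Set.ncard_coe_finset] at hle2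
  have h3 := hle2.trans Finset.card_image_le
  have h4 := Finset.card_erase_add_one z.2
  lia

section regular

lemma exists_nat_ringKrullDim (R : Type*) [CommRing R] [IsLocalRing R] [IsNoetherianRing R] :
    ∃ n : ℕ, ringKrullDim R = n := by
  have h1 : ringKrullDim R ≠ ⊥ := ringKrullDim_ne_bot
  have h2 : ringKrullDim R ≠ ⊤ := ringKrullDim_ne_top
  obtain ⟨n, hn⟩ := WithBot.ne_bot_iff_exists.mp h1
  cases n with
  | top => exact absurd hn.symm h2
  | coe n => exact ⟨n, hn.symm⟩

lemma IsRegularLocalRing.quotient {R : Type*} [CommRing R] [IsRegularLocalRing R] {x : R}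
    (hx : x ∈ maximalIdeal R) (hx2 : x ∉ maximalIdeal R ^ 2) :
    IsRegularLocalRing (R ⧸ Ideal.span {x}) := by
  have := isLocalRing_quotient_span hx
  apply IsRegularLocalRing.of_spanFinrank_maximalIdeal_le
  have h1 := spanFinrank_maximalIdeal_quotient_add_one_le hx hx2
  have h2 := (isRegularLocalRing_iff R).mp inferInstance
  have h3 := ringKrullDim_le_ringKrullDim_quotSMulTop_succ hx
  obtain ⟨n, hn⟩ := exists_nat_ringKrullDim (R ⧸ Ideal.span {x})
  have h4 : (Ideal.span {x} : Ideal R) = x • (⊤ : Ideal R) := by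
    simp [← Submodule.ideal_span_singleton_smul]
  rw [← ringKrullDim_eq_of_ringEquiv (Ideal.quotientEquivAlgOfEq R h4).toRingEquiv, hn, ← h2] at h3
  rw [hn]
  have h5 : (maximalIdeal R).spanFinrank ≤ n + 1 := by exact_mod_cast h3
  have h6 : (maximalIdeal (R ⧸ Ideal.span {x})).spanFinrank ≤ n := by lia
  exact_mod_cast h6

/-- A regular local ring is a domain. Modulo a minimal generator `x` of the maximal ideal outside
all minimal primes it is one by induction; so `(x)` is prime and contains a minimal prime `P` with
`P = x P`. -/
theorem IsRegularLocalRing.isDomain (R : Type*) [CommRing R] [IsRegularLocalRing R] :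
    IsDomain R := by
  obtain ⟨n, hn⟩ : ∃ n, (maximalIdeal R).spanFinrank = n := ⟨_, rfl⟩
  induction n using Nat.strong_induction_on generalizing R with
  | _ n ih =>
  by_cases hb : maximalIdeal R = ⊥
  · let := (isField_iff_maximalIdeal_eq.mpr hb).toField
    infer_instance
  have hdim := (isRegularLocalRing_iff R).mp inferInstance
  have hmin : ∀ P ∈ minimalPrimes R, ¬ maximalIdeal R ≤ P := by
    intro P hP hle
    have hP' : P.IsPrime := hP.1.1
    have heq : P = maximalIdeal R := le_antisymm (le_maximalIdeal hP'.ne_top) hle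
    have h0 : (maximalIdeal R).height = 0 := by
      rw [← heq]; exact Ideal.height_eq_zero_iff.mpr hP
    have h1 := IsLocalRing.maximalIdeal_height_eq_ringKrullDim (R := R)
    rw [h0, ← hdim] at h1
    have h2 : (maximalIdeal R).spanFinrank = 0 := by exact_mod_cast h1.symm
    exact hb ((Submodule.spanFinrank_eq_zero_iff_eq_bot (IsNoetherian.noetherian _)).mp h2)
  let s : Set (Ideal R) := {maximalIdeal R ^ 2} ∪ minimalPrimes R
  have hs : s.Finite := (Set.finite_singleton _).union (minimalPrimes.finite_of_isNoetherianRing R)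
  have hav := (Ideal.subset_union_prime_finite hs (f := id) (maximalIdeal R ^ 2)
    (maximalIdeal R ^ 2) (I := maximalIdeal R) (by
      rintro i (hi | hi) h1 -
      · exact absurd hi h1
      · exact hi.1.1)).not.mpr (by
      rintro ⟨i, (hi | hi), hle⟩
      · rw [Set.mem_singleton_iff] at hi
        subst hi; exact maximalIdeal_not_le_sq hb hle
      · exact hmin i hi hle)
  obtain ⟨x, hx, hxn⟩ := Set.not_subset.mp hav
  have hx2 : x ∉ maximalIdeal R ^ 2 := fun h ↦ hxn (Set.mem_biUnion (Or.inl rfl) h)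
  have := IsRegularLocalRing.quotient hx hx2
  have hlt := spanFinrank_maximalIdeal_quotient_add_one_le hx hx2
  have hdom := ih _ (by lia) (R ⧸ Ideal.span {x}) rfl
  have hprime : (Ideal.span {x}).IsPrime := (Ideal.Quotient.isDomain_iff_prime _).mp hdom
  obtain ⟨P, hP, hPle⟩ := Ideal.exists_minimalPrimes_le (bot_le (a := Ideal.span {x}))
  have hP' : P.IsPrime := hP.1.1
  have hxP : x ∉ P := fun h ↦ hxn (Set.mem_biUnion (Or.inr hP) h)
  have hPb : P = ⊥ := by
    refine Submodule.eq_bot_of_le_smul_of_le_jacobson_bot (maximalIdeal R) P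
      (IsNoetherian.noetherian _) ?_ (maximalIdeal_le_jacobson _)
    intro y hy
    obtain ⟨a, rfl⟩ := Ideal.mem_span_singleton'.mp (hPle hy)
    rw [mul_comm, smul_eq_mul]
    exact Ideal.mul_mem_mul hx ((hP'.mem_or_mem hy).resolve_right hxP)
  rw [hPb] at hP'
  exact IsDomain.of_bot_isPrime R

lemma IsRegularLocalRing.isSMulRegular {R : Type*} [CommRing R] [IsRegularLocalRing R] {x : R}
    (hx : x ≠ 0) : IsSMulRegular R x := by
  have := IsRegularLocalRing.isDomain R
  exact fun a b h ↦ mul_left_cancel₀ hx h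

/-- A regular local ring of positive dimension has a regular minimal generator of its maximal
ideal, whose quotient is again regular. -/
lemma IsRegularLocalRing.exists_quotient {R : Type*} [CommRing R] [IsRegularLocalRing R] {n : ℕ}
    (hn : ringKrullDim R = (n + 1 : ℕ)) : ∃ x ∈ maximalIdeal R, IsSMulRegular R x ∧
      IsRegularLocalRing (R ⧸ Ideal.span {x}) ∧ ringKrullDim (R ⧸ Ideal.span {x}) = n := by
  have hb : maximalIdeal R ≠ ⊥ := by
    intro hb
    have := ringKrullDim_eq_zero_of_isField (isField_iff_maximalIdeal_eq.mpr hb)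
    rw [this] at hn
    exact absurd hn (by exact_mod_cast (Nat.succ_ne_zero n).symm)
  obtain ⟨x, hx, hx2⟩ := Set.not_subset.mp (maximalIdeal_not_le_sq hb)
  have hreg : IsSMulRegular R x := IsRegularLocalRing.isSMulRegular (by
    rintro rfl; exact hx2 (zero_mem _))
  refine ⟨x, hx, hreg, IsRegularLocalRing.quotient hx hx2, ?_⟩
  have h := ringKrullDim_quotient_span_singleton_succ_eq_ringKrullDim hreg hx
  have := isLocalRing_quotient_span hx
  obtain ⟨k, hk⟩ := exists_nat_ringKrullDim (R ⧸ Ideal.span {x})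
  rw [hk, hn] at h
  rw [hk]
  have : k + 1 = n + 1 := by exact_mod_cast h
  exact_mod_cast Nat.succ_injective this

lemma IsRegularLocalRing.hasDepthGE {R : Type*} [CommRing R] [IsRegularLocalRing R] {n : ℕ}
    (hn : ringKrullDim R = n) : HasDepthGE R R n := by
  induction n generalizing R with
  | zero => exact .zero
  | succ n ih =>
    obtain ⟨x, hx, hreg, hR, hdim⟩ := IsRegularLocalRing.exists_quotient hn
    exact .of_quotSMulTop hx hreg ((HasDepthGE.quotient_iff.mp (ih hdim)).congr
      (quotSMulTopSelfEquiv x).symm)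

lemma HasDepthGE.natCast_le_ringKrullDim {R : Type*} [CommRing R] [IsLocalRing R]
    [IsNoetherianRing R] {n : ℕ} (h : HasDepthGE R R n) : (n : WithBot ℕ∞) ≤ ringKrullDim R := by
  obtain ⟨rs, rfl, h2, h3⟩ := h
  have hr := IsRegular.of_isWeaklyRegular_of_mem_maximalIdeal R h2 h3
  rw [← ringKrullDim_add_length_eq_ringKrullDim_of_isRegular rs hr]
  have : Nontrivial (R ⧸ Ideal.ofList rs) := by
    rw [Ideal.Quotient.nontrivial_iff]
    exact ne_top_of_le_ne_top (maximalIdeal.isMaximal R).ne_top (Ideal.span_le.mpr h2)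
  have h0 := ringKrullDim_nonneg_of_nontrivial (R := R ⧸ Ideal.ofList rs)
  calc ((rs.length : ℕ) : WithBot ℕ∞) = 0 + rs.length := by simp
    _ ≤ _ := by gcongr

end regular

/-! ### Hypersurfaces without completion -/

/-- A Cohen-Macaulay local ring of dimension `d` whose maximal ideal is generated by `d + 1`
elements. This is the part of the hypersurface condition that the argument uses; unlike the
presentation of the completion, it passes to quotients by regular elements outside the square of
the maximal ideal. -/
structure IsCohenMacaulayAlmostRegular (R : Type*) [CommRing R] [IsLocalRing R] (d : ℕ) :
    Prop where
  hasDepthGE : HasDepthGE R R d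
  dim_eq : ringKrullDim R = d
  spanFinrank_le : (maximalIdeal R).spanFinrank ≤ d + 1

namespace HasDepthGE

lemma of_ringEquiv {A B : Type*} [CommRing A] [CommRing B] [IsLocalRing A] [IsLocalRing B]
    (e : A ≃+* B) {n : ℕ} (h : HasDepthGE A A n) : HasDepthGE B B n := by
  obtain ⟨rs, h1, h2, h3⟩ := h
  refine ⟨rs.map e, by simpa using h1, ?_, ?_⟩
  · intro r hr
    obtain ⟨a, ha, rfl⟩ := List.mem_map.mp hr
    rw [mem_maximalIdeal, mem_nonunits_iff, MulEquiv.isUnit_map]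
    exact h2 a ha
  · refine (AddEquiv.isWeaklyRegular_congr (e := e.toAddEquiv) ?_).mp h3
    refine List.forall₂_map_right_iff.mpr (List.forall₂_same.mpr fun r _ x ↦ ?_)
    simp

/-- Depth descends along a flat local homomorphism whose closed fibre is a field. -/
lemma of_flat {A B : Type u} [CommRing A] [CommRing B] [IsLocalRing A] [IsLocalRing B]
    [IsNoetherianRing A] [IsNoetherianRing B] [Algebra A B] [Module.FaithfullyFlat A B]
    (hmax : (maximalIdeal A).map (algebraMap A B) = maximalIdeal B) {n : ℕ} (M : Type u)
    [AddCommGroup M] [Module A M] [Module.Finite A M] (h : HasDepthGE B (B ⊗[A] M) n) :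
    HasDepthGE A M n := by
  induction n generalizing M with
  | zero => exact .zero
  | succ n ih =>
    obtain ⟨x, hx, hreg⟩ : ∃ x ∈ maximalIdeal A, IsSMulRegular M x := by
      by_contra! hc
      -- otherwise some nonzero `u` is killed by the maximal ideal, and `1 ⊗ u` contradicts depth
      have hsub : (maximalIdeal A : Set A) ⊆ ⋃ p ∈ associatedPrimes A M, (p : Set A) := by
        rw [biUnion_associatedPrimes_eq_compl_regular]
        exact fun x hx ↦ hc x hx
      obtain ⟨P, hP, hle⟩ := (Ideal.subset_union_prime_finite (associatedPrimes.finite A M)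
        (f := id) ⊥ ⊥ (fun i hi _ _ ↦ hi.1)).mp hsub
      obtain ⟨hPp, u, hu⟩ := (isAssociatedPrime_iff (R := A) (M := M)).mp hP
      have hkill : ∀ a ∈ maximalIdeal A, a • u = 0 := by
        intro a ha
        have := hle ha
        simp only [id_eq, hu] at this
        simpa [Submodule.mem_colon_singleton] using this
      have hu0 : u ≠ 0 := by
        rintro rfl
        refine hPp.ne_top ?_
        rw [hu, Ideal.eq_top_iff_one]
        simp [Submodule.mem_colon_singleton]
      obtain ⟨y, hy, hyreg, -⟩ := h.exists_cons
      have hy0 : y • ((1 : B) ⊗ₜ[A] u) = 0 := by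
        rw [← hmax] at hy
        refine Submodule.span_induction ?_ ?_ ?_ ?_ hy
        · rintro _ ⟨a, ha, rfl⟩
          rw [algebraMap_smul, ← TensorProduct.tmul_smul, hkill a ha, TensorProduct.tmul_zero]
        · simp
        · intro a b _ _ ha hb; rw [add_smul, ha, hb, add_zero]
        · intro a b _ hb; rw [smul_assoc, hb, smul_zero]
      have h1 : (1 : B) ⊗ₜ[A] u = 0 := hyreg (by simpa using hy0)
      exact hu0 ((Module.FaithfullyFlat.one_tmul_eq_zero_iff A M u).mp h1)
    refine .of_quotSMulTop hx hreg (ih _ ?_)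
    have hxB : algebraMap A B x ∈ maximalIdeal B := by
      rw [← hmax]; exact Ideal.mem_map_of_mem _ hx
    have hregB : IsSMulRegular (B ⊗[A] M) (algebraMap A B x) := by
      have : IsSMulRegular (B ⊗[A] M) x := by
        have := (isWeaklyRegular_singleton_iff M x).mpr hreg
        exact (isWeaklyRegular_singleton_iff _ x).mp (this.isWeaklyRegular_lTensor)
      intro a b hab
      exact this (by simpa [algebraMap_smul] using hab)
    exact (h.quotSMulTop hxB hregB).congr (QuotSMulTop.algebraMapTensorEquivTensorQuotSMulTop x M B)

end HasDepthGE

/-- A hypersurface is Cohen-Macaulay with embedding dimension at most one more than its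
dimension. -/
theorem IsHypersurface.isCohenMacaulayAlmostRegular {R : Type u} [CommRing R]
    [IsLocalRing R] [IsNoetherianRing R] (hR : IsHypersurface R) {d : ℕ}
    (hd : ringKrullDim R = d) : IsCohenMacaulayAlmostRegular R d := by
  obtain ⟨Q, _, hQ, f, hf0, hf, ⟨e⟩⟩ := hR
  have hloc := isLocalRing_quotient_span hf
  obtain ⟨n, hn⟩ := exists_nat_ringKrullDim Q
  have hdim := (isRegularLocalRing_iff Q).mp inferInstance
  have hemb : (maximalIdeal Q).spanFinrank = n := by rw [hn] at hdim; exact_mod_cast hdim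
  obtain _ | k := n
  · have := (Submodule.spanFinrank_eq_zero_iff_eq_bot (IsNoetherian.noetherian _)).mp hemb
    rw [this] at hf
    exact absurd hf hf0
  have hnoeth : IsNoetherianRing (AdicCompletion (maximalIdeal R) R) :=
    isNoetherianRing_of_ringEquiv _ e.symm
  have hff : Module.FaithfullyFlat R (AdicCompletion (maximalIdeal R) R) :=
    Module.FaithfullyFlat.of_flat_of_isLocalHom
  have hdepth : HasDepthGE R R k := by
    have h1 := (IsRegularLocalRing.hasDepthGE hn).quotSMulTop hf
      (IsRegularLocalRing.isSMulRegular hf0)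
    have h2 := (HasDepthGE.quotient_iff (I := Ideal.span {f})).mpr
      (h1.congr (quotSMulTopSelfEquiv f))
    have h3 := h2.of_ringEquiv e.symm
    exact HasDepthGE.of_flat AdicCompletion.maximalIdeal_eq_map.symm R
      (h3.congr (TensorProduct.AlgebraTensorModule.rid R _ _).symm)
  have hembR : (maximalIdeal R).spanFinrank ≤ k + 1 := by
    rw [← AdicCompletion.spanFinrank_maximalIdeal_eq,
      ← Ideal.spanFinrank_map_eq_of_ringEquiv e, map_ringEquiv_maximalIdeal e,
      ← map_mk_maximalIdeal, ← hemb]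
    exact Ideal.spanFinrank_map_le_of_fg _ (IsNoetherian.noetherian _)
  have hkd : k ≤ d := by
    have := hdepth.natCast_le_ringKrullDim
    rw [hd] at this
    exact_mod_cast this
  refine ⟨?_, hd, by lia⟩
  rcases hkd.eq_or_lt with rfl | hlt
  · exact hdepth
  · -- here `R` itself is regular
    have : IsRegularLocalRing R := IsRegularLocalRing.of_spanFinrank_maximalIdeal_le R (by
      rw [hd]; exact_mod_cast hembR.trans hlt)
    exact IsRegularLocalRing.hasDepthGE hd

/-- The class is stable under quotients by a regular minimal generator of the maximal ideal. -/
lemma IsCohenMacaulayAlmostRegular.quotient {R : Type u} [CommRing R] [IsLocalRing R]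
    [IsNoetherianRing R] {d : ℕ} (h : IsCohenMacaulayAlmostRegular R (d + 1)) {x : R}
    (hx : x ∈ maximalIdeal R) (hx2 : x ∉ maximalIdeal R ^ 2) (hreg : IsSMulRegular R x)
    [IsLocalRing (R ⧸ Ideal.span {x})] :
    IsCohenMacaulayAlmostRegular (R ⧸ Ideal.span {x}) d where
  hasDepthGE := HasDepthGE.quotient_iff.mpr
    ((h.hasDepthGE.quotSMulTop hx hreg).congr (quotSMulTopSelfEquiv x))
  dim_eq := by
    have h1 := ringKrullDim_quotient_span_singleton_succ_eq_ringKrullDim hreg hx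
    obtain ⟨k, hk⟩ := exists_nat_ringKrullDim (R ⧸ Ideal.span {x})
    rw [hk, h.dim_eq] at h1
    have : k + 1 = d + 1 := by exact_mod_cast h1
    rw [hk, Nat.succ_injective this]
  spanFinrank_le := by
    have := spanFinrank_maximalIdeal_quotient_add_one_le hx hx2
    have := h.spanFinrank_le
    lia

namespace HasDepthGE

variable {R : Type u} [CommRing R] [IsLocalRing R] [IsNoetherianRing R]

/-- Two modules of positive depth over a ring in the class share a regular element with which the
dimension can be lowered. -/
lemma exists_common {d : ℕ} (h : IsCohenMacaulayAlmostRegular R (d + 1))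
    {A B : Type u} [AddCommGroup A] [Module R A] [Module.Finite R A] [AddCommGroup B] [Module R B]
    [Module.Finite R B] (hA : HasDepthGE R A (d + 1)) (hB : HasDepthGE R B (d + 1)) :
    ∃ x ∈ maximalIdeal R, x ∉ maximalIdeal R ^ 2 ∧ IsSMulRegular R x ∧ IsSMulRegular A x ∧
      IsSMulRegular B x := by
  obtain ⟨y, hy, hyreg, -⟩ := h.hasDepthGE.exists_cons
  exact exists_isSMulRegular_notMem_sq h.hasDepthGE.one_of_succ hA.one_of_succ hB.one_of_succ
    (maximalIdeal_not_le_sq (maximalIdeal_ne_bot_of_isSMulRegular hy hyreg))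

/-- Reduction of a module modulo `x`, as a module over `R / x`. -/
lemma reduce {M : Type u} [AddCommGroup M] [Module R M] [Module.Finite R M] {n : ℕ}
    (h : HasDepthGE R M (n + 1)) {x : R} (hx : x ∈ maximalIdeal R) (hreg : IsSMulRegular M x)
    [IsLocalRing (R ⧸ Ideal.span {x})] :
    HasDepthGE (R ⧸ Ideal.span {x}) (QuotSMulTop x M) n :=
  quotient_iff.mpr (h.quotSMulTop hx hreg)

end HasDepthGE

/-! ### Artinian local rings with principal maximal ideal -/

/-- The maximal ideal of `S` is generated by `t`, and `k + 1` is the nilpotency order of `t`. -/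
structure IsTruncatedUniformizer {S : Type*} [CommRing S] [IsLocalRing S] (t : S) (k : ℕ) :
    Prop where
  span_eq : Ideal.span {t} = maximalIdeal S
  pow_ne : t ^ k ≠ 0
  pow_eq : t ^ (k + 1) = 0

lemma IsCohenMacaulayAlmostRegular.exists_isTruncatedUniformizer {S : Type*} [CommRing S]
    [IsLocalRing S] [IsNoetherianRing S] (h : IsCohenMacaulayAlmostRegular S 0) :
    ∃ (t : S) (k : ℕ), IsTruncatedUniformizer t k := by
  classical
  obtain ⟨t, ht⟩ : ∃ t, Ideal.span {t} = maximalIdeal S := by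
    rcases (Nat.le_one_iff_eq_zero_or_eq_one.mp h.spanFinrank_le) with h0 | h1
    · exact ⟨0, by simp [(Submodule.spanFinrank_eq_zero_iff_eq_bot
        (IsNoetherian.noetherian _)).mp h0]⟩
    · obtain ⟨t, ht⟩ := ((Submodule.spanFinrank_eq_one_iff _).mp h1).1
      exact ⟨t, ht.symm⟩
  have hnil : IsNilpotent t := by
    have : Ring.KrullDimLE 0 S := by
      rw [Ring.krullDimLE_iff, h.dim_eq]
    have h1 : t ∈ maximalIdeal S := by rw [← ht]; exact Ideal.mem_span_singleton_self t
    exact (Ring.KrullDimLE.isNilpotent_iff_mem_maximalIdeal).mpr h1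
  have hpos : ∃ n, t ^ n = 0 := hnil
  have h0 : Nat.find hpos ≠ 0 := by
    intro h0
    have := Nat.find_spec hpos
    rw [h0, pow_zero] at this
    exact one_ne_zero this
  obtain ⟨k, hk⟩ := Nat.exists_eq_succ_of_ne_zero h0
  exact ⟨t, k, ht, Nat.find_min hpos (by lia), by
    have := Nat.find_spec hpos; rwa [hk] at this⟩

namespace IsTruncatedUniformizer

variable {S : Type u} [CommRing S] [IsLocalRing S] {t : S} {k : ℕ}
  (h : IsTruncatedUniformizer t k)
include h

lemma pow_mul_unit_eq_zero {a : ℕ} {s : S} (hs : IsUnit s) (h0 : t ^ a * s = 0) : k + 1 ≤ a := by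
  by_contra! hlt
  have h1 : t ^ a = 0 := (hs.mul_left_eq_zero).mp h0
  exact h.pow_ne (pow_eq_zero_of_le (by lia) h1)

lemma isUnit_of_notMem {s : S} (hs : s ∉ Ideal.span {t}) : IsUnit s := by
  rw [h.span_eq] at hs
  simpa using hs

/-- Every element is a unit times a power of the uniformizer. -/
lemma exists_eq_unit_mul (s : S) : ∃ (j : ℕ) (v : S), IsUnit v ∧ s = t ^ j * v := by
  classical
  by_cases hs : ∃ j, ¬ t ^ (j + 1) ∣ s
  · have h1 := Nat.find_spec hs
    have h2 : t ^ (Nat.find hs) ∣ s := by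
      rcases Nat.eq_zero_or_pos (Nat.find hs) with h0 | h0
      · simp [h0]
      · have := Nat.find_min hs (m := Nat.find hs - 1) (by lia)
        rw [Nat.sub_add_cancel h0] at this
        simpa using this
    obtain ⟨v, hv⟩ := h2
    refine ⟨Nat.find hs, v, h.isUnit_of_notMem fun hmem ↦ h1 ?_, hv⟩
    obtain ⟨w, rfl⟩ := Ideal.mem_span_singleton.mp hmem
    exact ⟨w, hv.trans (by ring)⟩
  · push Not at hs
    refine ⟨k + 1, 1, isUnit_one, ?_⟩
    obtain ⟨w, hw⟩ := hs k
    rw [hw, h.pow_eq, zero_mul, zero_mul]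

/-- The annihilator of `t ^ i` is generated by the complementary power of `t`. -/
lemma dvd_of_pow_mul_eq_zero {i : ℕ} {s : S} (h0 : t ^ i * s = 0) : t ^ (k + 1 - i) ∣ s := by
  obtain ⟨j, v, hv, rfl⟩ := h.exists_eq_unit_mul s
  rw [← mul_assoc, ← pow_add] at h0
  have := h.pow_mul_unit_eq_zero hv h0
  exact Dvd.dvd.mul_right (pow_dvd_pow t (by lia)) v

/-- An Artinian local ring with principal maximal ideal is self-injective. -/
lemma injective : Module.Injective S S := by
  apply Module.Baer.injective
  classical
  intro I g
  -- `I` is generated by the least power of `t` that it contains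
  have hex : ∃ n, t ^ n ∈ I := ⟨k + 1, by rw [h.pow_eq]; exact zero_mem _⟩
  set n := Nat.find hex with hn
  have hmem : t ^ n ∈ I := Nat.find_spec hex
  have hle : n ≤ k + 1 := Nat.find_min' hex (by rw [h.pow_eq]; exact zero_mem _)
  have hgen : ∀ x ∈ I, t ^ n ∣ x := by
    intro x hx
    obtain ⟨j, v, hv, rfl⟩ := h.exists_eq_unit_mul x
    have : t ^ j ∈ I := (Ideal.mul_unit_mem_iff_mem I hv).mp hx
    exact Dvd.dvd.mul_right (pow_dvd_pow t (Nat.find_min' hex this)) v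
  have hz : t ^ (k + 1 - n) * g ⟨t ^ n, hmem⟩ = 0 := by
    rw [← smul_eq_mul, ← map_smul]
    have : (t ^ (k + 1 - n) • (⟨t ^ n, hmem⟩ : I)) = 0 := by
      ext
      simp only [SetLike.mk_smul_mk, smul_eq_mul, ← pow_add, Nat.sub_add_cancel hle, h.pow_eq,
        ZeroMemClass.coe_zero]
    rw [this, map_zero]
  obtain ⟨z, hz⟩ := h.dvd_of_pow_mul_eq_zero hz
  rw [show k + 1 - (k + 1 - n) = n by lia] at hz
  refine ⟨LinearMap.toSpanSingleton S S z, fun x hx ↦ ?_⟩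
  obtain ⟨y, rfl⟩ := hgen x hx
  have : (⟨t ^ n * y, hx⟩ : I) = y • ⟨t ^ n, hmem⟩ := by
    ext; simp [mul_comm]
  rw [this, map_smul, hz]
  simp; ring

/-- Self-injectivity and a simple socle make every module torsionless. -/
lemma exists_dual_ne_zero {N : Type u} [AddCommGroup N] [Module S N] {u : N} (hu : u ≠ 0) :
    ∃ φ : N →ₗ[S] S, φ u ≠ 0 := by
  classical
  have hinj := h.injective
  have hex : ∃ n, t ^ n • u = 0 := ⟨k + 1, by rw [h.pow_eq, zero_smul]⟩
  have h0 : Nat.find hex ≠ 0 := by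
    intro h0
    have := Nat.find_spec hex
    rw [h0, pow_zero, one_smul] at this
    exact hu this
  obtain ⟨j, hj⟩ := Nat.exists_eq_succ_of_ne_zero h0
  have hw0 : t ^ j • u ≠ 0 := Nat.find_min hex (by lia)
  have htw : t • t ^ j • u = 0 := by
    have := Nat.find_spec hex
    rwa [hj, pow_succ', mul_smul] at this
  let f : (S ⧸ Ideal.span {t}) →ₗ[S] N := Submodule.liftQSpanSingleton t
    (LinearMap.toSpanSingleton S N (t ^ j • u)) (by simpa using htw)
  let g : (S ⧸ Ideal.span {t}) →ₗ[S] S := Submodule.liftQSpanSingleton t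
    (LinearMap.toSpanSingleton S S (t ^ k)) (by
      simp only [LinearMap.toSpanSingleton_apply, smul_eq_mul]; rw [← pow_succ', h.pow_eq])
  have hf : Injective f := by
    rw [injective_iff_map_eq_zero]
    intro y
    obtain ⟨s, rfl⟩ := Submodule.Quotient.mk_surjective _ y
    intro hy
    have hs : s • t ^ j • u = 0 := hy
    by_contra hc
    have : IsUnit s := h.isUnit_of_notMem (fun hmem ↦ hc ((Submodule.Quotient.mk_eq_zero _).mpr hmem))
    exact hw0 ((this.smul_eq_zero).mp hs)
  obtain ⟨φ, hφ⟩ := hinj.out f hf g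
  refine ⟨φ, fun hc ↦ h.pow_ne ?_⟩
  have h1 : f (Submodule.Quotient.mk 1) = t ^ j • u := by
    change (1 : S) • t ^ j • u = _
    rw [one_smul]
  have h2 : g (Submodule.Quotient.mk 1) = t ^ k := by
    change (1 : S) • t ^ k = _
    rw [one_smul]
  rw [← h2, ← hφ, h1, map_smul, hc, smul_zero]

/-- A finitely generated module that is not free has a direct summand `S / t ^ b` with
`0 < b ≤ k`, given here by a generator `v` and a functional modulo `t ^ b` with value one at `v`.
With `L ⊆ t G` the relations of a minimal presentation by a free module `G`, `b` is the largest
exponent with `L ⊆ t ^ b G`. -/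
lemma exists_summand [IsNoetherianRing S] {N : Type u} [AddCommGroup N] [Module S N]
    [Module.Finite S N] (hN : ¬ Module.Free S N) :
    ∃ (b : ℕ) (v : N) (r : N →ₗ[S] (S ⧸ Ideal.span {t ^ b})), 0 < b ∧ b ≤ k ∧ t ^ b • v = 0 ∧
      r v = Ideal.Quotient.mk _ 1 := by
  classical
  have hex : ∃ n, ∃ π : (Fin n → S) →ₗ[S] N, Surjective π := Module.Finite.exists_fin' S N
  obtain ⟨n, ⟨π, hπ⟩, hnmin⟩ : ∃ n, (∃ π : (Fin n → S) →ₗ[S] N, Surjective π) ∧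
      ∀ m < n, ¬ ∃ π : (Fin m → S) →ₗ[S] N, Surjective π :=
    ⟨Nat.find hex, Nat.find_spec hex, fun m hm ↦ Nat.find_min hex hm⟩
  -- the presentation is minimal
  have hmin : ∀ l, π l = 0 → ∀ i, t ∣ l i := by
    intro l hl i
    by_contra hc
    have hu : IsUnit (l i) := h.isUnit_of_notMem fun hm ↦ hc (Ideal.mem_span_singleton.mp hm)
    obtain ⟨w, hw⟩ := hu.exists_left_inv
    have hn0 : 0 < n := Fin.pos i
    -- the `i`-th generator is a combination of the others
    obtain ⟨m, hm⟩ : ∃ m, n = m + 1 := ⟨n - 1, by lia⟩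
    subst hm
    refine hnmin m (by lia) ⟨π ∘ₗ (LinearMap.pi fun j ↦
      (if hj : ∃ q, i.succAbove q = j then LinearMap.proj hj.choose else 0)), ?_⟩
    intro y
    obtain ⟨g, rfl⟩ := hπ y
    let g' : Fin (m + 1) → S := g - (g i * w) • l
    have hg' : π g' = π g := by simp [g', hl]
    have hgi : g' i = 0 := by simp [g', mul_assoc, hw]
    refine ⟨fun q ↦ g' (i.succAbove q), ?_⟩
    rw [← hg', LinearMap.comp_apply]
    congr 1
    ext j
    rw [LinearMap.pi_apply]
    by_cases hj : ∃ q, i.succAbove q = j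
    · rw [dif_pos hj, LinearMap.proj_apply, hj.choose_spec]
    · rw [dif_neg hj, LinearMap.zero_apply]
      by_cases hij : j = i
      · rw [hij, hgi]
      · exact absurd (Fin.exists_succAbove_eq hij) hj
  -- there is a nonzero relation
  obtain ⟨l₀, hl₀, hl₀0⟩ : ∃ l, π l = 0 ∧ l ≠ 0 := by
    by_contra! hc
    exact hN (Module.Free.of_equiv (LinearEquiv.ofBijective π
      ⟨(injective_iff_map_eq_zero π).mpr hc, hπ⟩))
  have hex2 : ∃ c, ¬ ∀ l, π l = 0 → ∀ i, t ^ c ∣ l i := by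
    refine ⟨k + 1, fun hc ↦ hl₀0 (funext fun i ↦ ?_)⟩
    have := hc l₀ hl₀ i
    rwa [h.pow_eq, zero_dvd_iff] at this
  obtain ⟨c, hc, hcmin⟩ : ∃ c, (¬ ∀ l, π l = 0 → ∀ i, t ^ c ∣ l i) ∧
      ∀ b < c, ∀ l, π l = 0 → ∀ i, t ^ b ∣ l i :=
    ⟨Nat.find hex2, Nat.find_spec hex2, fun b hb ↦ not_not.mp (Nat.find_min hex2 hb)⟩
  have hlt : 2 ≤ c := by
    by_contra! hlt
    refine hc fun l hl i ↦ dvd_trans (pow_dvd_pow t (Nat.lt_succ_iff.mp hlt)) ?_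
    rw [pow_one]
    exact hmin l hl i
  obtain ⟨b, rfl⟩ : ∃ b, c = b + 1 := ⟨c - 1, by lia⟩
  have hall := hcmin b (by lia)
  push Not at hc
  obtain ⟨l, hl, i, hi⟩ := hc
  choose v hv using hall l hl
  have hvi : IsUnit (v i) := by
    refine h.isUnit_of_notMem fun hm ↦ hi ?_
    obtain ⟨w, hw⟩ := Ideal.mem_span_singleton.mp hm
    exact ⟨w, by rw [hv, hw]; ring⟩
  obtain ⟨w, hw⟩ := hvi.exists_left_inv
  have hker : LinearMap.ker π ≤ LinearMap.ker
      ((Ideal.span {t ^ b}).mkQ ∘ₗ (w • LinearMap.proj i : (Fin n → S) →ₗ[S] S)) := by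
    intro g hg
    rw [LinearMap.mem_ker, LinearMap.comp_apply, Submodule.mkQ_apply,
      Submodule.Quotient.mk_eq_zero]
    obtain ⟨z, hz⟩ := hall g hg i
    refine Ideal.mem_span_singleton.mpr ⟨w * z, ?_⟩
    simp [hz]; ring
  let e := LinearMap.quotKerEquivOfSurjective π hπ
  refine ⟨b, π v, (LinearMap.ker π).liftQ _ hker ∘ₗ e.symm.toLinearMap, by lia, ?_, ?_, ?_⟩
  · by_contra! hlt
    refine hi ?_
    have h0 : l i = 0 := by rw [hv, pow_eq_zero_of_le hlt h.pow_eq, zero_mul]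
    simp [h0]
  · rw [← map_smul, ← hl]
    congr 1
    ext j
    simp [hv j]
  · have h1 : e.symm (π v) = Submodule.Quotient.mk v := by
      rw [LinearEquiv.symm_apply_eq]; rfl
    rw [LinearMap.comp_apply, LinearEquiv.coe_coe, h1, Submodule.liftQ_apply]
    simp [hw]

end IsTruncatedUniformizer

/-! ### Reduction modulo a regular element -/

section reduction

variable {R : Type*} [CommRing R] (x : R)

lemma mem_smul_top_iff {M : Type*} [AddCommGroup M] [Module R M] {m : M} :
    m ∈ (x • ⊤ : Submodule R M) ↔ ∃ m', m = x • m' := by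
  rw [Submodule.mem_smul_pointwise_iff_exists]
  exact ⟨fun ⟨b, _, h⟩ ↦ ⟨b, h.symm⟩, fun ⟨b, h⟩ ↦ ⟨b, trivial, h.symm⟩⟩

variable {M N P : Type*} [AddCommGroup M] [Module R M] [AddCommGroup N] [Module R N]
  [AddCommGroup P] [Module R P]

/-- The map induced by `f` modulo `x`, as a map of modules over `R / x`. -/
noncomputable def QuotSMulTop.mapQuot (f : M →ₗ[R] N) :
    QuotSMulTop x M →ₗ[R ⧸ Ideal.span {x}] QuotSMulTop x N :=
  (QuotSMulTop.map x f).extendScalarsOfSurjective Ideal.Quotient.mk_surjective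

@[simp]
lemma QuotSMulTop.mapQuot_mk (f : M →ₗ[R] N) (m : M) :
    QuotSMulTop.mapQuot x f (Submodule.Quotient.mk m) = Submodule.Quotient.mk (f m) := rfl

/-- The functional induced by `f` modulo `x`. -/
noncomputable def QuotSMulTop.dualQuot (f : M →ₗ[R] R) :
    QuotSMulTop x M →ₗ[R ⧸ Ideal.span {x}] R ⧸ Ideal.span {x} :=
  ((quotSMulTopSelfEquiv x).toLinearMap ∘ₗ QuotSMulTop.map x f).extendScalarsOfSurjective
    Ideal.Quotient.mk_surjective

@[simp]
lemma QuotSMulTop.dualQuot_mk (f : M →ₗ[R] R) (m : M) :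
    QuotSMulTop.dualQuot x f (Submodule.Quotient.mk m) = Ideal.Quotient.mk _ (f m) := rfl

variable {x} {f : M →ₗ[R] N} {g : N →ₗ[R] P}

lemma QuotSMulTop.mapQuot_exact (hfg : Exact f g) (hg : Surjective g) :
    Exact (QuotSMulTop.mapQuot x f) (QuotSMulTop.mapQuot x g) :=
  QuotSMulTop.map_exact x hfg hg

lemma QuotSMulTop.mapQuot_surjective (hg : Surjective g) :
    Surjective (QuotSMulTop.mapQuot x g) :=
  QuotSMulTop.map_surjective x hg

lemma QuotSMulTop.mapQuot_injective (hf : Injective f) (hfg : Exact f g)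
    (hx : IsSMulRegular P x) : Injective (QuotSMulTop.mapQuot x f) := by
  rw [injective_iff_map_eq_zero]
  intro m
  obtain ⟨m, rfl⟩ := Submodule.Quotient.mk_surjective _ m
  intro hm
  rw [mapQuot_mk, Submodule.Quotient.mk_eq_zero, mem_smul_top_iff] at hm
  obtain ⟨n, hn⟩ := hm
  have h0 : g n = 0 := hx (by
    change x • g n = x • 0
    rw [← map_smul, ← hn, smul_zero, hfg.apply_apply_eq_zero])
  obtain ⟨m', rfl⟩ := (hfg n).mp h0
  rw [← map_smul] at hn
  rw [Submodule.Quotient.mk_eq_zero, mem_smul_top_iff]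
  exact ⟨m', hf hn⟩

/-- If `C` is the cokernel of `f`, and `f` is injective modulo an element regular on the target,
then that element is regular on `C`. -/
lemma isSMulRegular_coker (hfg : Exact f g) (hg : Surjective g) (hx : IsSMulRegular N x)
    (hinj : Injective (QuotSMulTop.mapQuot x f)) : IsSMulRegular P x := by
  rw [isSMulRegular_iff_right_eq_zero_of_smul]
  intro p hp
  obtain ⟨n, rfl⟩ := hg p
  rw [← map_smul] at hp
  obtain ⟨m, hm⟩ := (hfg _).mp hp
  have h0 : (Submodule.Quotient.mk m : QuotSMulTop x M) = 0 := hinj (by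
    rw [QuotSMulTop.mapQuot_mk, map_zero, Submodule.Quotient.mk_eq_zero, mem_smul_top_iff]
    exact ⟨n, hm⟩)
  rw [Submodule.Quotient.mk_eq_zero, mem_smul_top_iff] at h0
  obtain ⟨m', rfl⟩ := h0
  rw [map_smul] at hm
  exact (hfg _).mpr ⟨m', hx hm⟩

/-- By Nakayama's lemma, injectivity modulo an element regular on the target implies
injectivity. -/
lemma injective_of_mapQuot_injective [IsLocalRing R] [IsNoetherianRing R] [Module.Finite R M]
    (hxm : x ∈ maximalIdeal R) (hx : IsSMulRegular N x)
    (hinj : Injective (QuotSMulTop.mapQuot x f)) : Injective f := by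
  rw [← LinearMap.ker_eq_bot]
  refine Submodule.eq_bot_of_le_smul_of_le_jacobson_bot (maximalIdeal R) _
    (IsNoetherian.noetherian _) ?_ (maximalIdeal_le_jacobson _)
  intro m hm
  have h0 : (Submodule.Quotient.mk m : QuotSMulTop x M) = 0 := hinj (by
    rw [QuotSMulTop.mapQuot_mk, LinearMap.mem_ker.mp hm, map_zero, Submodule.Quotient.mk_zero])
  rw [Submodule.Quotient.mk_eq_zero, mem_smul_top_iff] at h0
  obtain ⟨m', rfl⟩ := h0
  refine Submodule.smul_mem_smul hxm (LinearMap.mem_ker.mpr (hx ?_))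
  rw [LinearMap.mem_ker, map_smul] at hm
  change x • f m' = x • 0
  rw [hm, smul_zero]

/-- A functional with values in `(x)` is divisible by `x`, for `x` regular. -/
lemma exists_eq_smul_of_forall_mem_span (hx : IsSMulRegular R x) (φ : M →ₗ[R] R)
    (h : ∀ m, φ m ∈ Ideal.span {x}) : ∃ ψ : M →ₗ[R] R, φ = x • ψ := by
  choose ψ hψ using fun m ↦ Ideal.mem_span_singleton.mp (h m)
  refine ⟨⟨⟨ψ, fun a b ↦ hx ?_⟩, fun r a ↦ hx ?_⟩, LinearMap.ext hψ⟩
  · change x * _ = x * _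
    rw [mul_add, ← hψ, ← hψ, ← hψ, map_add]
  · change x * _ = x * _
    rw [← hψ, map_smul, hψ, RingHom.id_apply, smul_eq_mul, smul_eq_mul]
    ring

end reduction

lemma isSMulRegular_of_free {R : Type*} [CommRing R] {x : R} (hx : IsSMulRegular R x)
    (F : Type*) [AddCommGroup F] [Module R F] [Module.Free R F] : IsSMulRegular F x :=
  fun a b hab ↦ (Module.Free.chooseBasis R F).repr.injective (Finsupp.ext fun i ↦ hx (by
    have := congrArg (fun z ↦ (Module.Free.chooseBasis R F).repr z i) hab
    simpa using this))

lemma isSMulRegular_of_injective {R : Type*} [CommRing R] {x : R} {M N : Type*} [AddCommGroup M]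
    [Module R M] [AddCommGroup N] [Module R N] {f : M →ₗ[R] N} (hf : Injective f)
    (hx : IsSMulRegular N x) : IsSMulRegular M x :=
  fun a b hab ↦ hf (hx (by
    change x • f a = x • f b
    rw [← map_smul, ← map_smul]; exact congrArg f hab))

/-- Functionals modulo `x` on a free module lift. -/
lemma QuotSMulTop.exists_lift_of_free {R : Type*} [CommRing R] (x : R) {F : Type*}
    [AddCommGroup F] [Module R F] [Module.Free R F]
    (φ' : QuotSMulTop x F →ₗ[R ⧸ Ideal.span {x}] R ⧸ Ideal.span {x}) :
    ∃ φ : F →ₗ[R] R, ∀ f, Ideal.Quotient.mk (Ideal.span {x}) (φ f) =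
      φ' (Submodule.Quotient.mk f) := by
  obtain ⟨φ, hφ⟩ := Module.projective_lifting_property (Ideal.span {x}).mkQ
    ((φ'.restrictScalars R) ∘ₗ (Submodule.mkQ (x • ⊤ : Submodule R F)))
    (Submodule.mkQ_surjective _)
  exact ⟨φ, LinearMap.congr_fun hφ⟩

/-- The depth lemma for kernels, by induction: a common regular element of `F` and `N` is regular on
the kernel, and the sequence stays exact modulo it. -/
lemma HasDepthGE.ker {R : Type u} [CommRing R] [IsLocalRing R] [IsNoetherianRing R]
    (hm : ¬ maximalIdeal R ≤ maximalIdeal R ^ 2) {n : ℕ} {K F N : Type u} [AddCommGroup K]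
    [Module R K] [Module.Finite R K] [AddCommGroup F] [Module R F] [Module.Finite R F]
    [AddCommGroup N] [Module R N] [Module.Finite R N] {j : K →ₗ[R] F} {π : F →ₗ[R] N}
    (hj : Injective j) (hjπ : Exact j π) (hπ : Surjective π) (hF : HasDepthGE R F n)
    (hN : HasDepthGE R N n) : HasDepthGE R K n := by
  induction n generalizing K F N with
  | zero => exact .zero
  | succ n ih =>
    obtain ⟨x, hx, -, hxF, hxN, -⟩ := exists_isSMulRegular_notMem_sq hF.one_of_succ hN.one_of_succ
      hN.one_of_succ hm
    exact .of_quotSMulTop hx (isSMulRegular_of_injective hj hxF)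
      (ih (j := QuotSMulTop.map x j) (π := QuotSMulTop.map x π)
        (QuotSMulTop.mapQuot_injective hj hjπ hxN) (QuotSMulTop.map_exact x hjπ hπ)
        (QuotSMulTop.map_surjective x hπ) (hF.quotSMulTop hx hxF) (hN.quotSMulTop hx hxN))

/-! ### Duality for maximal Cohen-Macaulay modules -/

namespace IsCohenMacaulayAlmostRegular

/-- The vanishing of `Ext¹(N, R)` for `N` maximal Cohen-Macaulay: functionals on the kernel of
`F → N` extend to the free module `F`. Modulo a regular element this holds by induction, the case
of dimension zero being self-injectivity, and Nakayama's lemma lifts it. -/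
theorem exists_extension {d : ℕ} {R : Type u} [CommRing R] [IsLocalRing R] [IsNoetherianRing R]
    (h : IsCohenMacaulayAlmostRegular R d) {K F N : Type u} [AddCommGroup K]
    [Module R K] [AddCommGroup F] [Module R F] [Module.Finite R F] [Module.Free R F]
    [AddCommGroup N] [Module R N] {j : K →ₗ[R] F} {π : F →ₗ[R] N}
    (hj : Injective j) (hjπ : Exact j π) (hπ : Surjective π) (hN : HasDepthGE R N d)
    (g : K →ₗ[R] R) : ∃ φ : F →ₗ[R] R, φ ∘ₗ j = g := by
  induction d generalizing R K F N with
  | zero =>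
    obtain ⟨t, k, ht⟩ := h.exists_isTruncatedUniformizer
    obtain ⟨φ, hφ⟩ := ht.injective.out j hj g
    exact ⟨φ, LinearMap.ext hφ⟩
  | succ d ih =>
    have : Module.Finite R N := Module.Finite.of_surjective π hπ
    have : Module.Finite R K := Module.Finite.of_injective j hj
    obtain ⟨x, hx, hx2, hxR, hxN, -⟩ := HasDepthGE.exists_common h hN hN
    have := isLocalRing_quotient_span hx
    have step : ∀ g : K →ₗ[R] R, ∃ (φ : F →ₗ[R] R) (g' : K →ₗ[R] R), g = φ ∘ₗ j + x • g' := by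
      intro g
      have hfin : Module.Finite (R ⧸ Ideal.span {x}) (QuotSMulTop x F) :=
        Module.Finite.of_restrictScalars_finite R _ _
      obtain ⟨φ', hφ'⟩ := ih (h.quotient hx hx2 hxR) (QuotSMulTop.mapQuot_injective hj hjπ hxN)
        (QuotSMulTop.mapQuot_exact hjπ hπ) (QuotSMulTop.mapQuot_surjective hπ)
        (hN.reduce hx hxN) (QuotSMulTop.dualQuot x g)
      obtain ⟨φ, hφ⟩ := QuotSMulTop.exists_lift_of_free x φ'
      obtain ⟨g', hg'⟩ := exists_eq_smul_of_forall_mem_span hxR (g - φ ∘ₗ j) (fun m ↦ by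
        rw [← Ideal.Quotient.eq_zero_iff_mem, LinearMap.sub_apply, map_sub, sub_eq_zero]
        rw [LinearMap.comp_apply, hφ, ← QuotSMulTop.mapQuot_mk, ← QuotSMulTop.dualQuot_mk, ← hφ',
          LinearMap.comp_apply])
      exact ⟨φ, g', by rw [← hg']; abel⟩
    have hle : (⊤ : Submodule R (K →ₗ[R] R)) ≤ LinearMap.range (LinearMap.lcomp R R j) := by
      refine Submodule.le_of_le_smul_of_le_jacobson_bot (I := maximalIdeal R)
        (IsNoetherian.noetherian _) (maximalIdeal_le_jacobson _) ?_
      intro g _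
      obtain ⟨φ, g', rfl⟩ := step g
      exact Submodule.add_mem_sup ⟨φ, rfl⟩ (Submodule.smul_mem_smul hx trivial)
    obtain ⟨φ, hφ⟩ := hle (show g ∈ ⊤ from trivial)
    exact ⟨φ, hφ⟩

/-- Functionals modulo a regular element lift. -/
lemma exists_lift_dualQuot {d : ℕ} {R : Type u} [CommRing R] [IsLocalRing R] [IsNoetherianRing R]
    (h : IsCohenMacaulayAlmostRegular R d) {N : Type u} [AddCommGroup N] [Module R N]
    [Module.Finite R N] (hN : HasDepthGE R N d) {x : R} (hxR : IsSMulRegular R x)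
    (φ' : QuotSMulTop x N →ₗ[R ⧸ Ideal.span {x}] R ⧸ Ideal.span {x}) :
    ∃ φ : N →ₗ[R] R, QuotSMulTop.dualQuot x φ = φ' := by
  obtain ⟨n, π, hπ⟩ := Module.Finite.exists_fin' R N
  obtain ⟨ψ, hψ⟩ := QuotSMulTop.exists_lift_of_free x (φ' ∘ₗ QuotSMulTop.mapQuot x π)
  have hψ' : ∀ f, Ideal.Quotient.mk (Ideal.span {x}) (ψ f) =
      φ' (Submodule.Quotient.mk (π f)) := by
    intro f
    rw [hψ, LinearMap.comp_apply, QuotSMulTop.mapQuot_mk]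
  obtain ⟨g, hg⟩ := exists_eq_smul_of_forall_mem_span hxR (ψ ∘ₗ (LinearMap.ker π).subtype)
    (fun m ↦ by
      rw [← Ideal.Quotient.eq_zero_iff_mem]
      refine (hψ' _).trans ?_
      rw [Submodule.subtype_apply, LinearMap.mem_ker.mp m.2, Submodule.Quotient.mk_zero, map_zero])
  obtain ⟨G, hG⟩ := h.exists_extension (LinearMap.ker π).subtype_injective
    (LinearMap.exact_subtype_ker_map π) hπ hN g
  have hker : LinearMap.ker π ≤ LinearMap.ker (ψ - x • G) := by
    intro m hm
    have h1 := LinearMap.congr_fun hg ⟨m, hm⟩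
    have h2 := LinearMap.congr_fun hG ⟨m, hm⟩
    rw [LinearMap.mem_ker, LinearMap.sub_apply, sub_eq_zero]
    refine h1.trans ?_
    rw [← hG]; rfl
  let e := LinearMap.quotKerEquivOfSurjective π hπ
  refine ⟨(LinearMap.ker π).liftQ _ hker ∘ₗ e.symm.toLinearMap, ?_⟩
  refine LinearMap.ext fun m ↦ ?_
  obtain ⟨m, rfl⟩ := Submodule.Quotient.mk_surjective _ m
  obtain ⟨f, rfl⟩ := hπ m
  have h1 : e.symm (π f) = Submodule.Quotient.mk f := by
    rw [LinearEquiv.symm_apply_eq]; rfl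
  rw [QuotSMulTop.dualQuot_mk, LinearMap.comp_apply, LinearEquiv.coe_coe, h1,
    Submodule.liftQ_apply, ← hψ', LinearMap.sub_apply, map_sub, LinearMap.smul_apply, smul_eq_mul,
    map_mul, Ideal.Quotient.eq_zero_iff_mem.mpr (Ideal.mem_span_singleton_self x), zero_mul,
    sub_zero]

/-- A map from a maximal Cohen-Macaulay module `N` to a free module through which all functionals
on `N` factor is injective, with maximal Cohen-Macaulay cokernel. -/
theorem injective_and_hasDepthGE_coker {d : ℕ} {R : Type u} [CommRing R] [IsLocalRing R]
    [IsNoetherianRing R] (h : IsCohenMacaulayAlmostRegular R d) {N F C : Type u} [AddCommGroup N]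
    [Module R N] [Module.Finite R N] [AddCommGroup F] [Module R F] [Module.Finite R F]
    [Module.Free R F] [AddCommGroup C] [Module R C] {ι : N →ₗ[R] F} {π : F →ₗ[R] C}
    (hιπ : Exact ι π) (hπ : Surjective π) (hN : HasDepthGE R N d)
    (hfac : ∀ φ : N →ₗ[R] R, ∃ ψ : F →ₗ[R] R, ψ ∘ₗ ι = φ) :
    Injective ι ∧ HasDepthGE R C d := by
  induction d generalizing R N F C with
  | zero =>
    refine ⟨(injective_iff_map_eq_zero ι).mpr fun u hu ↦ ?_, .zero⟩
    by_contra hc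
    obtain ⟨t, k, ht⟩ := h.exists_isTruncatedUniformizer
    obtain ⟨φ, hφ⟩ := ht.exists_dual_ne_zero hc
    obtain ⟨ψ, rfl⟩ := hfac φ
    exact hφ (by simp [hu])
  | succ d ih =>
    have : Module.Finite R C := Module.Finite.of_surjective π hπ
    obtain ⟨x, hx, hx2, hxR, hxN, -⟩ := HasDepthGE.exists_common h hN hN
    have := isLocalRing_quotient_span hx
    have hfin : Module.Finite (R ⧸ Ideal.span {x}) (QuotSMulTop x F) :=
      Module.Finite.of_restrictScalars_finite R _ _
    have hfin' : Module.Finite (R ⧸ Ideal.span {x}) (QuotSMulTop x N) :=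
      Module.Finite.of_restrictScalars_finite R _ _
    have hxF := isSMulRegular_of_free hxR F
    obtain ⟨hinj, hC⟩ := ih (h.quotient hx hx2 hxR) (QuotSMulTop.mapQuot_exact (x := x) hιπ hπ)
      (QuotSMulTop.mapQuot_surjective hπ) (hN.reduce hx hxN) (fun φ' ↦ by
        obtain ⟨φ, rfl⟩ := h.exists_lift_dualQuot hN hxR φ'
        obtain ⟨ψ, rfl⟩ := hfac φ
        refine ⟨QuotSMulTop.dualQuot x ψ, ?_⟩
        refine LinearMap.ext fun m ↦ ?_
        obtain ⟨m, rfl⟩ := Submodule.Quotient.mk_surjective _ m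
        rw [LinearMap.comp_apply, QuotSMulTop.mapQuot_mk, QuotSMulTop.dualQuot_mk,
          QuotSMulTop.dualQuot_mk, LinearMap.comp_apply])
    exact ⟨injective_of_mapQuot_injective hx hxF hinj,
      .of_quotSMulTop hx (isSMulRegular_coker hιπ hπ hxF hinj) (HasDepthGE.quotient_iff.mp hC)⟩

/-- A maximal Cohen-Macaulay module embeds in a free module with maximal Cohen-Macaulay
cokernel. -/
theorem exists_embedding {d : ℕ} {R : Type u} [CommRing R] [IsLocalRing R]
    [IsNoetherianRing R] (h : IsCohenMacaulayAlmostRegular R d) {N : Type u} [AddCommGroup N]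
    [Module R N] [Module.Finite R N] (hN : HasDepthGE R N d) :
    ∃ (n : ℕ) (ι : N →ₗ[R] (Fin n → R)), Injective ι ∧
      HasDepthGE R ((Fin n → R) ⧸ LinearMap.range ι) d := by
  obtain ⟨n, s, hs⟩ := Module.Finite.exists_fin (R := R) (M := N →ₗ[R] R)
  refine ⟨n, LinearMap.pi s, h.injective_and_hasDepthGE_coker
    (LinearMap.exact_map_mkQ_range _) (Submodule.mkQ_surjective _) hN fun φ ↦ ?_⟩
  have : φ ∈ Submodule.span R (Set.range s) := by rw [hs]; trivial
  obtain ⟨c, rfl⟩ := (Submodule.mem_span_range_iff_exists_fun R).mp this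
  refine ⟨∑ i, c i • LinearMap.proj i, ?_⟩
  ext m
  simp

/-- If a maximal Cohen-Macaulay module has a free first syzygy, it is free. -/
theorem free_of_free_syzygy {d : ℕ} {R : Type u} [CommRing R] [IsLocalRing R]
    [IsNoetherianRing R] (h : IsCohenMacaulayAlmostRegular R d) {K F N : Type u} [AddCommGroup K]
    [Module R K] [Module.Free R K] [AddCommGroup F] [Module R F] [Module.Finite R F]
    [Module.Free R F] [AddCommGroup N] [Module R N] {j : K →ₗ[R] F} {π : F →ₗ[R] N}
    (hj : Injective j) (hjπ : Exact j π) (hπ : Surjective π) (hN : HasDepthGE R N d) :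
    Module.Free R N := by
  have : Module.Finite R N := Module.Finite.of_surjective π hπ
  have : Module.Finite R K := Module.Finite.of_injective j hj
  let b := Module.Free.chooseBasis R K
  choose φ hφ using fun i ↦ h.exists_extension hj hjπ hπ hN (b.coord i)
  let r : F →ₗ[R] K := ∑ i, (φ i).smulRight (b i)
  have hr : r ∘ₗ j = LinearMap.id := by
    ext m
    have h1 : ∀ i, φ i (j m) = b.repr m i := fun i ↦ LinearMap.congr_fun (hφ i) m
    simp only [r, LinearMap.comp_apply, LinearMap.sum_apply, LinearMap.smulRight_apply, h1,
      LinearMap.id_apply]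
    exact b.sum_repr m
  obtain ⟨s, hs⟩ := ((Function.Exact.split_tfae hjπ hj hπ).out 1 0 :
    (∃ l, l ∘ₗ j = LinearMap.id) ↔ _).mp ⟨r, hr⟩
  have : Module.Projective R N := Module.Projective.of_split s π hs
  exact Module.free_of_flat_of_isLocalRing

end IsCohenMacaulayAlmostRegular

/-! ### Complexes of finite free modules with coefficients -/

namespace Matrix

variable {R : Type*} [CommRing R] {m n : Type*} [Fintype n]

/-- The action of a matrix over `R` on vectors with entries in an `R`-module `M`, that is, the
map `M ⊗ R ^ n → M ⊗ R ^ m`. -/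
noncomputable def coeffMap (A : Matrix m n R) (M : Type*) [AddCommGroup M] [Module R M] :
    (n → M) →ₗ[R] (m → M) :=
  LinearMap.pi fun i ↦ ∑ j, A i j • LinearMap.proj j

lemma coeffMap_apply (A : Matrix m n R) {M : Type*} [AddCommGroup M] [Module R M] (v : n → M)
    (i : m) : A.coeffMap M v i = ∑ j, A i j • v j := by
  simp [coeffMap]

/-- The matrix action is natural in the module and the ring. -/
lemma coeffMap_map {S : Type*} [CommRing S] (σ : R →+* S) (A : Matrix m n R) {M : Type*}
    [AddCommGroup M] [Module R M] {M' : Type*} [AddCommGroup M'] [Module S M'] (p : M →+ M')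
    (hp : ∀ (r : R) (y : M), p (r • y) = σ r • p y) (v : n → M) :
    (A.map σ).coeffMap M' (fun j ↦ p (v j)) = fun i ↦ p (A.coeffMap M v i) := by
  ext i
  simp [coeffMap_apply, hp]

lemma coeffMap_smul_right (A : Matrix m n R) {M : Type*} [AddCommGroup M] [Module R M]
    (w : n → R) (y : M) : A.coeffMap M (fun j ↦ w j • y) = fun i ↦ A.coeffMap R w i • y := by
  ext i
  simp [coeffMap_apply, Finset.sum_smul, mul_smul]

end Matrix

section exactness

variable {R : Type*} [CommRing R] {a₀ a₁ a₂ a₃ : Type*} [Fintype a₁] [Fintype a₂] [Fintype a₃]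
  {A₀ : Matrix a₀ a₁ R} {A₁ : Matrix a₁ a₂ R} {A₂ : Matrix a₂ a₃ R}

/-- If `x` is regular on `M`, then exactness with coefficients in `M` at two consecutive positions
gives exactness with coefficients in `M / x` at the left one. -/
lemma exact_coeffMap_quotient {M : Type*} [AddCommGroup M] [Module R M] {x : R}
    (hx : IsSMulRegular M x) {S : Type*} [CommRing S] (σ : R →+* S) (hσ : σ x = 0) {M' : Type*}
    [AddCommGroup M'] [Module S M'] (p : M →+ M') (hp : ∀ (r : R) (y : M), p (r • y) = σ r • p y)
    (hpsurj : Surjective p) (hpker : ∀ y, p y = 0 → ∃ y', y = x • y')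
    (h₁ : Exact (A₁.coeffMap M) (A₀.coeffMap M)) (h₂ : Exact (A₂.coeffMap M) (A₁.coeffMap M)) :
    Exact ((A₂.map σ).coeffMap M') ((A₁.map σ).coeffMap M') := by
  intro v'
  constructor
  · intro hv'
    choose v hv using fun j ↦ hpsurj (v' j)
    obtain rfl : (fun j ↦ p (v j)) = v' := funext hv
    rw [Matrix.coeffMap_map σ _ p hp] at hv'
    choose u hu using fun i ↦ hpker _ (congrFun hv' i)
    have hu' : A₁.coeffMap M v = x • u := funext hu
    have h0 : A₀.coeffMap M u = 0 := by
      have : x • A₀.coeffMap M u = 0 := by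
        rw [← map_smul, ← hu', h₁.apply_apply_eq_zero]
      exact funext fun i ↦ hx (by simpa using congrFun this i)
    obtain ⟨w, rfl⟩ := (h₁ u).mp h0
    have h1 : A₁.coeffMap M (v - x • w) = 0 := by rw [map_sub, map_smul, hu', sub_self]
    obtain ⟨z, hz⟩ := (h₂ _).mp h1
    refine ⟨fun j ↦ p (z j), ?_⟩
    rw [Matrix.coeffMap_map σ _ p hp, hz]
    ext j
    simp [hp, hσ]
  · rintro ⟨w', rfl⟩
    choose w hw using fun j ↦ hpsurj (w' j)
    obtain rfl : (fun j ↦ p (w j)) = w' := funext hw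
    rw [Matrix.coeffMap_map σ _ p hp, Matrix.coeffMap_map σ _ p hp, h₂.apply_apply_eq_zero]
    ext
    simp

end exactness

/-- A presentation by a matrix `A` reduces modulo `x` to a presentation by `A` modulo `x`. -/
lemma exists_presentation_quotient {R : Type*} [CommRing R] (x : R) {a b : Type*} [Fintype a]
    [Fintype b] [DecidableEq a] {N : Type*} [AddCommGroup N] [Module R N] {A : Matrix a b R}
    {π : (a → R) →ₗ[R] N} (hA : Exact (A.coeffMap R) π) (hπ : Surjective π) :
    ∃ π' : (a → R ⧸ Ideal.span {x}) →ₗ[R ⧸ Ideal.span {x}] QuotSMulTop x N,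
      Surjective π' ∧ Exact ((A.map (Ideal.Quotient.mk (Ideal.span {x}))).coeffMap _) π' := by
  let q := Ideal.Quotient.mk (Ideal.span {x})
  let π' : (a → R ⧸ Ideal.span {x}) →ₗ[R ⧸ Ideal.span {x}] QuotSMulTop x N :=
    Fintype.linearCombination (R ⧸ Ideal.span {x})
      (fun i ↦ (Submodule.Quotient.mk (π (Pi.single i 1)) : QuotSMulTop x N))
  have hπ' : ∀ v : a → R, π' (fun i ↦ q (v i)) = Submodule.Quotient.mk (π v) := by
    intro v
    have h1 : π v = ∑ i, v i • π (Pi.single i 1) := by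
      conv_lhs => rw [← LinearMap.sum_single_apply (fun _ : a ↦ R) v, map_sum]
      refine Finset.sum_congr rfl fun i _ ↦ ?_
      rw [← map_smul]
      congr 1
      ext j
      simp [Pi.single_apply]
    rw [h1, Fintype.linearCombination_apply]
    exact (map_sum (Submodule.mkQ (x • ⊤ : Submodule R N)) _ _).symm
  have hlift : ∀ v' : a → R ⧸ Ideal.span {x}, ∃ v : a → R, (fun i ↦ q (v i)) = v' := by
    intro v'
    choose v hv using fun i ↦ Ideal.Quotient.mk_surjective (v' i)
    exact ⟨v, funext hv⟩
  have hq : ∀ (r y : R), q.toAddMonoidHom (r • y) = q r • q.toAddMonoidHom y := by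
    intro r y; exact map_mul q r y
  refine ⟨π', fun y ↦ ?_, fun v' ↦ ⟨fun hv' ↦ ?_, ?_⟩⟩
  · obtain ⟨y, rfl⟩ := Submodule.Quotient.mk_surjective _ y
    obtain ⟨v, rfl⟩ := hπ y
    exact ⟨_, hπ' v⟩
  · obtain ⟨v, rfl⟩ := hlift v'
    rw [hπ', Submodule.Quotient.mk_eq_zero, mem_smul_top_iff] at hv'
    obtain ⟨y, hy⟩ := hv'
    obtain ⟨u, rfl⟩ := hπ y
    obtain ⟨w, hw⟩ := (hA (v - x • u)).mp (by rw [map_sub, map_smul, hy, sub_self])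
    refine ⟨fun j ↦ q (w j), ?_⟩
    refine (Matrix.coeffMap_map q A q.toAddMonoidHom hq w).trans ?_
    rw [hw]
    ext i
    change q (v i - x * u i) = q (v i)
    rw [map_sub, map_mul, Ideal.Quotient.eq_zero_iff_mem.mpr (Ideal.mem_span_singleton_self x),
      zero_mul, sub_zero]
  · rintro ⟨w', rfl⟩
    obtain ⟨w, rfl⟩ : ∃ w : b → R, (fun i ↦ q (w i)) = w' := by
      choose w hw using fun i ↦ Ideal.Quotient.mk_surjective (w' i)
      exact ⟨w, funext hw⟩
    have h1 := Matrix.coeffMap_map q A q.toAddMonoidHom hq w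
    refine (congrArg π' h1).trans ((hπ' _).trans ?_)
    rw [hA.apply_apply_eq_zero, Submodule.Quotient.mk_zero]

/-- Over an Artinian local ring with principal maximal ideal, `Tor₁(M, N) = 0` forces `M` or `N`
to be free: otherwise `M` and `N` have summands `S / t ^ b` and `S / t ^ c`, whose first `Tor` is
nonzero. -/
theorem IsTruncatedUniformizer.free_or_free {S : Type u} [CommRing S] [IsLocalRing S]
    [IsNoetherianRing S] {t : S} {k : ℕ} (ht : IsTruncatedUniformizer t k) {M N : Type u}
    [AddCommGroup M] [Module S M] [Module.Finite S M] [AddCommGroup N] [Module S N]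
    [Module.Finite S N] {a₀ a₁ a₂ : Type*} [Fintype a₀] [Fintype a₁] [Fintype a₂]
    {A₀ : Matrix a₀ a₁ S} {A₁ : Matrix a₁ a₂ S} {π : (a₀ → S) →ₗ[S] N} (hπ : Surjective π)
    (h₀ : Exact (A₀.coeffMap S) π) (h₁ : Exact (A₁.coeffMap S) (A₀.coeffMap S))
    (hM : Exact (A₁.coeffMap M) (A₀.coeffMap M)) : Module.Free S M ∨ Module.Free S N := by
  by_contra! hfree
  obtain ⟨b, v, r, hb, hbk, hbv, hrv⟩ := ht.exists_summand hfree.1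
  obtain ⟨c, n, ρ, hc, hck, hcn, hρn⟩ := ht.exists_summand hfree.2
  -- exactness passes from `M` to its summand `S / t ^ b`: a relation divisible by `t ^ b` is
  -- `t ^ b` times a relation
  have key : ∀ w g, A₀.coeffMap S w = t ^ b • g → ∃ w', A₀.coeffMap S w = t ^ b • A₀.coeffMap S w' := by
    intro w g hwg
    obtain ⟨u, hu⟩ := (hM (fun j ↦ w j • v)).mp (by
      rw [Matrix.coeffMap_smul_right, hwg]
      ext i
      rw [Pi.smul_apply, smul_eq_mul, mul_comm, mul_smul, hbv, smul_zero, Pi.zero_apply])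
    choose z hz using fun j ↦ Ideal.Quotient.mk_surjective (r (u j))
    have h2 : ∀ i, w i - A₁.coeffMap S z i ∈ Ideal.span {t ^ b} := by
      intro i
      rw [← Ideal.Quotient.eq_zero_iff_mem, map_sub, sub_eq_zero]
      have h3 : r (w i • v) = r (A₁.coeffMap M u i) := by rw [hu]
      rw [map_smul, hrv, Matrix.coeffMap_apply, map_sum] at h3
      rw [Matrix.coeffMap_apply, map_sum]
      have h4 : Ideal.Quotient.mk (Ideal.span {t ^ b}) (w i) =
          w i • Ideal.Quotient.mk (Ideal.span {t ^ b}) 1 := by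
        rw [← Ideal.Quotient.mk_eq_mk, ← Ideal.Quotient.mk_eq_mk, ← Submodule.Quotient.mk_smul]
        simp
      rw [h4, h3]
      refine Finset.sum_congr rfl fun j _ ↦ ?_
      rw [map_smul, ← hz, smul_eq_mul, map_mul]
      rfl
    choose w' hw' using fun i ↦ Ideal.mem_span_singleton.mp (h2 i)
    refine ⟨w', ?_⟩
    have h5 : w = A₁.coeffMap S z + t ^ b • w' := by
      ext i
      simp [← hw']
    conv_lhs => rw [h5]
    rw [map_add, h₁.apply_apply_eq_zero, zero_add, map_smul]
  -- apply `key` to the relation `t ^ max b c • f`, where `f` lifts the generator of `S / t ^ c`;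
  -- the functional `l` on the free module lifts the projection of `N` onto `S / t ^ c`
  obtain ⟨f, rfl⟩ := hπ n
  obtain ⟨l, hl⟩ := Module.projective_lifting_property (Ideal.span {t ^ c}).mkQ (ρ ∘ₗ π)
    (Submodule.mkQ_surjective _)
  have hl' : ∀ g, Ideal.Quotient.mk (Ideal.span {t ^ c}) (l g) = ρ (π g) := LinearMap.congr_fun hl
  have hmax : t ^ (max b c) • π f = 0 := by
    rw [show max b c = (max b c - c) + c by lia, pow_add, mul_smul, hcn, smul_zero]
  obtain ⟨w, hw⟩ := (h₀ (t ^ (max b c) • f)).mp (by rw [map_smul, hmax])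
  obtain ⟨w', hw'⟩ := key w (t ^ (max b c - b) • f) (by
    rw [hw, smul_smul, ← pow_add]; congr 2; lia)
  rw [hw] at hw'
  obtain ⟨s, hs⟩ : t ^ c ∣ l (A₀.coeffMap S w') := by
    rw [← Ideal.mem_span_singleton, ← Ideal.Quotient.eq_zero_iff_mem, hl',
      h₀.apply_apply_eq_zero, map_zero]
  obtain ⟨s', hs'⟩ : t ^ c ∣ l f - 1 := by
    rw [← Ideal.mem_span_singleton, ← Ideal.Quotient.eq_zero_iff_mem, map_sub, hl', hρn, sub_self]
  have h6 := congrArg l hw'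
  rw [map_smul, map_smul, hs, smul_eq_mul, smul_eq_mul] at h6
  -- `t ^ max b c` times a unit vanishes, although `max b c ≤ k`
  have h7 : t ^ (max b c) * (1 + t * (t ^ (c - 1) * s' - t ^ (b + c - max b c - 1) * s)) = 0 := by
    have h8 : l f = 1 + t ^ c * s' := by rw [← hs']; ring
    rw [h8] at h6
    have h9 : t ^ c = t * t ^ (c - 1) := by rw [← pow_succ']; congr 1; lia
    have h10 : t ^ b * t ^ c = t ^ (max b c) * (t * t ^ (b + c - max b c - 1)) := by
      rw [← pow_succ', ← pow_add, ← pow_add]; congr 1; lia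
    rw [← mul_assoc (t ^ b), h10] at h6
    calc _ = t ^ (max b c) * (1 + (t * t ^ (c - 1)) * s') -
          t ^ (max b c) * (t * t ^ (b + c - max b c - 1)) * s := by ring
      _ = 0 := by rw [← h9, h6, sub_self]
  have hunit : IsUnit (1 + t * (t ^ (c - 1) * s' - t ^ (b + c - max b c - 1) * s)) := by
    refine ht.isUnit_of_notMem fun hmem ↦ ?_
    have h11 : (1 : S) ∈ Ideal.span {t} :=
      (Ideal.add_mem_iff_left _ (Ideal.mem_span_singleton.mpr (dvd_mul_right _ _))).mp hmem
    rw [ht.span_eq] at h11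
    exact (mem_maximalIdeal (1 : S)).mp h11 isUnit_one
  have := ht.pow_mul_unit_eq_zero hunit h7
  lia

/-- Maximal Cohen-Macaulay modules `M` and `N` with `Tor_i(M, N) = 0` for `1 ≤ i ≤ d + 1`: one of
them is free. The vanishing is stated for a free resolution of `N` given by matrices. Modulo a
regular element, `Tor` vanishes in one degree less for `M` and the syzygy of `N`. -/
theorem IsCohenMacaulayAlmostRegular.free_or_free {d : ℕ} {R : Type u} [CommRing R]
    [IsLocalRing R] [IsNoetherianRing R] (h : IsCohenMacaulayAlmostRegular R d) {M N : Type u}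
    [AddCommGroup M] [Module R M] [Module.Finite R M] [AddCommGroup N] [Module R N]
    (hM : HasDepthGE R M d) (hN : HasDepthGE R N d) (a : ℕ → ℕ)
    (A : ∀ i, Matrix (Fin (a i)) (Fin (a (i + 1))) R) {π : (Fin (a 0) → R) →ₗ[R] N}
    (hπ : Surjective π) (h₀ : Exact ((A 0).coeffMap R) π)
    (hAR : ∀ i ≤ d, Exact ((A (i + 1)).coeffMap R) ((A i).coeffMap R))
    (hAM : ∀ i ≤ d, Exact ((A (i + 1)).coeffMap M) ((A i).coeffMap M)) :
    Module.Free R M ∨ Module.Free R N := by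
  induction d generalizing R M N a with
  | zero =>
    have : Module.Finite R N := Module.Finite.of_surjective π hπ
    obtain ⟨t, k, ht⟩ := h.exists_isTruncatedUniformizer
    exact ht.free_or_free hπ h₀ (hAR 0 le_rfl) (hAM 0 le_rfl)
  | succ d ih =>
    have : Module.Finite R N := Module.Finite.of_surjective π hπ
    obtain ⟨x, hx, hx2, hxR, hxM, hxN⟩ := HasDepthGE.exists_common h hM hN
    have := isLocalRing_quotient_span hx
    have hfin : Module.Finite (R ⧸ Ideal.span {x}) (QuotSMulTop x M) :=
      Module.Finite.of_restrictScalars_finite R _ _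
    -- the induction hypothesis is applied to `M / x` and `K / x`, for `K` the first syzygy of `N`
    let K := LinearMap.ker π
    have hK : HasDepthGE R K (d + 1) := by
      refine HasDepthGE.ker (maximalIdeal_not_le_sq (maximalIdeal_ne_bot_of_isSMulRegular hx hxR))
        K.subtype_injective (LinearMap.exact_subtype_ker_map π) hπ ?_ hN
      obtain ⟨rs, h1, h2, h3⟩ := h.hasDepthGE
      exact ⟨rs, h1, h2, (h3.isWeaklyRegular_lTensor (M₂ := Fin (a 0) → R)) |>
        ((TensorProduct.rid R (Fin (a 0) → R)).isWeaklyRegular_congr rs).mp⟩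
    have hxK : IsSMulRegular K x :=
      isSMulRegular_of_injective K.subtype_injective (isSMulRegular_of_free hxR _)
    let π₁ : (Fin (a 1) → R) →ₗ[R] K := ((A 0).coeffMap R).codRestrict K
      fun w ↦ h₀.apply_apply_eq_zero w
    have hπ₁ : Surjective π₁ := by
      rintro ⟨y, hy⟩
      obtain ⟨w, rfl⟩ := (h₀ y).mp hy
      exact ⟨w, rfl⟩
    have hAπ₁ : Exact ((A 1).coeffMap R) π₁ := by
      intro w
      rw [← hAR 0 (by lia) w, Subtype.ext_iff]
      rfl
    obtain ⟨π', hπ', hAπ'⟩ := exists_presentation_quotient x hAπ₁ hπ₁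
    have hmk : ∀ (r : R) (y : M), (Submodule.mkQ (x • ⊤ : Submodule R M)).toAddMonoidHom (r • y) =
        Ideal.Quotient.mk (Ideal.span {x}) r •
          (Submodule.mkQ (x • ⊤ : Submodule R M)).toAddMonoidHom y := fun r y ↦ rfl
    rcases ih (h.quotient hx hx2 hxR) (hM.reduce hx hxM) (hK.reduce hx hxK) (fun i ↦ a (i + 1))
      (fun i ↦ (A (i + 1)).map (Ideal.Quotient.mk (Ideal.span {x}))) hπ' hAπ'
      (fun i hi ↦ exact_coeffMap_quotient hxR (Ideal.Quotient.mk (Ideal.span {x}))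
        (Ideal.Quotient.eq_zero_iff_mem.mpr (Ideal.mem_span_singleton_self x))
        (Ideal.Quotient.mk (Ideal.span {x})).toAddMonoidHom
        (fun r y ↦ map_mul (Ideal.Quotient.mk (Ideal.span {x})) r y)
        Ideal.Quotient.mk_surjective (fun y hy ↦
          Ideal.mem_span_singleton.mp (Ideal.Quotient.eq_zero_iff_mem.mp hy))
        (hAR i (by lia)) (hAR (i + 1) (by lia)))
      (fun i hi ↦ exact_coeffMap_quotient hxM (Ideal.Quotient.mk (Ideal.span {x}))
        (Ideal.Quotient.eq_zero_iff_mem.mpr (Ideal.mem_span_singleton_self x))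
        (Submodule.mkQ (x • ⊤ : Submodule R M)).toAddMonoidHom hmk
        (Submodule.mkQ_surjective _) (fun y hy ↦
          mem_smul_top_iff x |>.mp ((Submodule.Quotient.mk_eq_zero _).mp hy))
        (hAM i (by lia)) (hAM (i + 1) (by lia))) with hfree | hfree
    · left
      have := Module.finitePresentation_of_finite R M
      exact (Module.free_quotSMulTop_iff_free _ _ (maximalIdeal_le_jacobson _ hx) hxM).mp hfree
    · right
      have := Module.finitePresentation_of_finite R K
      have hKfree : Module.Free R K :=
        (Module.free_quotSMulTop_iff_free _ _ (maximalIdeal_le_jacobson _ hx) hxK).mp hfree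
      exact h.free_of_free_syzygy K.subtype_injective (LinearMap.exact_subtype_ker_map π) hπ hN

/-! ### Iterated syzygies and the punctured spectrum -/

/-- `L` is an `n`-th syzygy: there is an exact sequence `0 → L → F₁ → ⋯ → Fₙ → C → 0` of finitely
generated modules with all `Fᵢ` free. -/
def IsSyzygy (R : Type u) [CommRing R] : ℕ → (L : Type u) → [AddCommGroup L] → [Module R L] → Prop
  | 0, L, _, _ => Module.Finite R L
  | n + 1, L, _, _ => ∃ (F C : Type u) (_ : AddCommGroup F) (_ : Module R F) (_ : AddCommGroup C)
      (_ : Module R C) (ι : L →ₗ[R] F) (π : F →ₗ[R] C), Module.Finite R F ∧ Module.Free R F ∧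
        Injective ι ∧ Exact ι π ∧ Surjective π ∧ IsSyzygy R n C

/-- A maximal Cohen-Macaulay module is a syzygy of every order. -/
lemma IsCohenMacaulayAlmostRegular.isSyzygy {d : ℕ} {R : Type u} [CommRing R] [IsLocalRing R]
    [IsNoetherianRing R] (h : IsCohenMacaulayAlmostRegular R d) (n : ℕ) {N : Type u}
    [AddCommGroup N] [Module R N] [Module.Finite R N] (hN : HasDepthGE R N d) :
    IsSyzygy R n N := by
  induction n generalizing N with
  | zero => assumption
  | succ n ih =>
    obtain ⟨m, ι, hι, hC⟩ := h.exists_embedding hN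
    exact ⟨Fin m → R, (Fin m → R) ⧸ LinearMap.range ι, _, _, _, _, ι, Submodule.mkQ _,
      inferInstance, inferInstance, hι, LinearMap.exact_map_mkQ_range _,
      Submodule.mkQ_surjective _, ih hC⟩

namespace IsSyzygy

lemma localizedModule {R : Type u} [CommRing R] (S : Submonoid R) {n : ℕ} {L : Type u}
    [AddCommGroup L] [Module R L] (h : IsSyzygy R n L) :
    IsSyzygy (Localization S) n (LocalizedModule S L) := by
  induction n generalizing L with
  | zero =>
    have : Module.Finite R L := h
    exact Module.Finite.of_isLocalizedModule S (LocalizedModule.mkLinearMap S L)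
  | succ n ih =>
    obtain ⟨F, C, _, _, _, _, ι, π, hfin, hfree, hι, hιπ, hπ, hC⟩ := h
    exact ⟨LocalizedModule S F, LocalizedModule S C, _, _, _, _, LocalizedModule.map S ι,
      LocalizedModule.map S π, .of_isLocalizedModule S (LocalizedModule.mkLinearMap S F),
      Module.free_of_isLocalizedModule S (LocalizedModule.mkLinearMap S F),
      LocalizedModule.map_injective S ι hι, LocalizedModule.map_exact S ι π hιπ,
      LocalizedModule.map_surjective S π hπ, ih hC⟩

lemma finite {R : Type u} [CommRing R] [IsNoetherianRing R] {n : ℕ} {L : Type u}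
    [AddCommGroup L] [Module R L] (h : IsSyzygy R n L) : Module.Finite R L := by
  cases n with
  | zero => exact h
  | succ n =>
    obtain ⟨F, C, _, _, _, _, ι, π, hfin, hfree, hι, -⟩ := h
    exact Module.Finite.of_injective ι hι

lemma isSMulRegular {R : Type u} [CommRing R] {n : ℕ} {L : Type u} [AddCommGroup L] [Module R L]
    (h : IsSyzygy R (n + 1) L) {x : R} (hx : IsSMulRegular R x) : IsSMulRegular L x := by
  obtain ⟨F, C, _, _, _, _, ι, π, hfin, hfree, hι, -⟩ := h
  exact isSMulRegular_of_injective hι (isSMulRegular_of_free hx F)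

/-- Reduction modulo a regular element costs one step of a syzygy. -/
lemma quotSMulTop {R : Type u} [CommRing R] [IsNoetherianRing R] {n : ℕ} {L : Type u}
    [AddCommGroup L] [Module R L] (h : IsSyzygy R (n + 1) L) {x : R} (hx : IsSMulRegular R x) :
    IsSyzygy (R ⧸ Ideal.span {x}) n (QuotSMulTop x L) := by
  induction n generalizing L with
  | zero =>
    have := h.finite
    exact Module.Finite.of_restrictScalars_finite R _ _
  | succ n ih =>
    obtain ⟨F, C, _, _, _, _, ι, π, hfin, hfree, hι, hιπ, hπ, hC⟩ := h
    exact ⟨QuotSMulTop x F, QuotSMulTop x C, _, _, _, _, QuotSMulTop.mapQuot x ι,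
      QuotSMulTop.mapQuot x π, Module.Finite.of_restrictScalars_finite R _ _, inferInstance,
      QuotSMulTop.mapQuot_injective hι hιπ (hC.isSMulRegular hx),
      QuotSMulTop.mapQuot_exact hιπ hπ, QuotSMulTop.mapQuot_surjective hπ, ih hC⟩

/-- Over a regular local ring of dimension `n` all `n`-th syzygies are free. -/
theorem free_of_isRegularLocalRing {n : ℕ} {R : Type u} [CommRing R] [IsRegularLocalRing R]
    (hn : ringKrullDim R = n) {L : Type u} [AddCommGroup L] [Module R L] (h : IsSyzygy R n L) :
    Module.Free R L := by
  induction n generalizing R L with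
  | zero =>
    have hdim := (isRegularLocalRing_iff R).mp inferInstance
    rw [hn] at hdim
    have hb := (Submodule.spanFinrank_eq_zero_iff_eq_bot
      (IsNoetherian.noetherian (maximalIdeal R))).mp (by exact_mod_cast hdim)
    let := (isField_iff_maximalIdeal_eq.mpr hb).toField
    exact Module.Free.of_divisionRing R L
  | succ n ih =>
    have := h.finite
    have := Module.finitePresentation_of_finite R L
    obtain ⟨x, hx, hreg, hR, hdim⟩ := IsRegularLocalRing.exists_quotient hn
    exact (Module.free_quotSMulTop_iff_free _ _ (maximalIdeal_le_jacobson _ hx)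
      (h.isSMulRegular hreg)).mp (ih hdim (h.quotSMulTop hreg))

end IsSyzygy

/-- If the cokernel of `ι` is projective at `p`, then `ι` has a retraction up to a scalar outside
`p`. -/
lemma exists_smul_retraction {R : Type u} [CommRing R] (p : Ideal R) [p.IsPrime] {N F C : Type u}
    [AddCommGroup N] [Module R N] [Module.Finite R N] [AddCommGroup F] [Module R F]
    [Module.FinitePresentation R F] [AddCommGroup C] [Module R C] {ι : N →ₗ[R] F}
    {π : F →ₗ[R] C} (hι : Injective ι) (hιπ : Exact ι π) (hπ : Surjective π)
    [Module.Projective (Localization.AtPrime p) (LocalizedModule p.primeCompl C)] :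
    ∃ s ∉ p, ∃ r : F →ₗ[R] N, ∀ n, r (ι n) = s • n := by
  let S := p.primeCompl
  obtain ⟨σ, hσ⟩ := Module.projective_lifting_property (LocalizedModule.map S π) LinearMap.id
    (LocalizedModule.map_surjective S π hπ)
  have hex : Exact (LocalizedModule.map S ι) (LocalizedModule.map S π) :=
    LocalizedModule.map_exact S ι π hιπ
  have htfae := (hex.split_tfae (LocalizedModule.map_injective S ι hι)
    (LocalizedModule.map_surjective S π hπ)).out 0 1
  obtain ⟨l, hl⟩ := htfae.mp ⟨σ, hσ⟩
  obtain ⟨r, s, hr⟩ := Module.FinitePresentation.exists_lift_of_isLocalizedModule S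
    (LocalizedModule.mkLinearMap S N) ((l.restrictScalars R) ∘ₗ LocalizedModule.mkLinearMap S F)
  have hcomp : LocalizedModule.mkLinearMap S N ∘ₗ (r ∘ₗ ι) =
      LocalizedModule.mkLinearMap S N ∘ₗ ((s : R) • LinearMap.id) := by
    ext n
    have h1 := LinearMap.congr_fun hr (ι n)
    have h2 := LinearMap.congr_fun hl (LocalizedModule.mkLinearMap S N n)
    have h3 : LocalizedModule.map S ι (LocalizedModule.mkLinearMap S N n) =
        LocalizedModule.mkLinearMap S F (ι n) := LocalizedModule.map_mk S ι n 1
    rw [LinearMap.comp_apply, h3] at h2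
    refine h1.trans ?_
    change (s : R) • l (LocalizedModule.mkLinearMap S F (ι n)) = _
    rw [h2]
    simp
  obtain ⟨s', hs'⟩ := Module.Finite.exists_smul_of_comp_eq_of_isLocalizedModule S
    (LocalizedModule.mkLinearMap S N) (r ∘ₗ ι) _ hcomp
  refine ⟨s' * s, fun hmem ↦ (p.primeCompl.mul_mem s'.2 s.2) hmem, (s' : R) • r, fun n ↦ ?_⟩
  rw [mul_smul]
  exact LinearMap.congr_fun hs' n

/-- If `M ⊗ N` has a regular element in the maximal ideal and the cokernel of `N → F` is
projective on the punctured spectrum, then `M ⊗ N → M ⊗ F` is injective: elements of its kernel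
are killed by a power of the maximal ideal. -/
theorem lTensor_injective_of_isSMulRegular {R : Type u} [CommRing R] [IsLocalRing R]
    (M : Type u) [AddCommGroup M] [Module R M] {N F C : Type u}
    [AddCommGroup N] [Module R N] [Module.Finite R N] [AddCommGroup F] [Module R F]
    [Module.FinitePresentation R F] [AddCommGroup C] [Module R C] {ι : N →ₗ[R] F}
    {π : F →ₗ[R] C} (hι : Injective ι) (hιπ : Exact ι π) (hπ : Surjective π)
    (hC : ∀ (p : Ideal R) [p.IsPrime], p ≠ maximalIdeal R →
      Module.Projective (Localization.AtPrime p) (LocalizedModule p.primeCompl C))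
    {x : R} (hx : x ∈ maximalIdeal R) (hreg : IsSMulRegular (M ⊗[R] N) x) :
    Injective (ι.lTensor M) := by
  rw [injective_iff_map_eq_zero]
  intro u hu
  -- the annihilator of `u` lies in no prime other than the maximal ideal
  have hrad : x ∈ Ideal.radical (LinearMap.ker (LinearMap.toSpanSingleton R _ u)) := by
    rw [Ideal.radical_eq_sInf, Submodule.mem_sInf]
    rintro p ⟨hle, hp⟩
    by_cases hpm : p = maximalIdeal R
    · rwa [hpm]
    · have := hC p hpm
      obtain ⟨s, hs, r, hr⟩ := exists_smul_retraction p hι hιπ hπ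
      have hcomp : r ∘ₗ ι = s • LinearMap.id := LinearMap.ext hr
      have h1 : s • u = 0 := by
        have h2 : (r ∘ₗ ι).lTensor M u = s • u := by
          rw [hcomp, LinearMap.lTensor_smul, LinearMap.lTensor_id]; rfl
        rw [← h2, LinearMap.lTensor_comp, LinearMap.comp_apply, hu, map_zero]
      exact absurd (hle (by simpa using h1)) hs
  obtain ⟨k, hk⟩ := hrad
  have h3 : x ^ k • u = 0 := by simpa using hk
  exact (hreg.pow k) (by simpa using h3)

/-! ### Free resolutions given by matrices and `Tor` -/

/-- A resolution `⋯ → R ^ a₂ → R ^ a₁ → R ^ a₀ → N → 0` by finite free modules, with the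
differentials given as matrices. -/
structure MatrixResolution (R : Type u) [CommRing R] (N : Type u) [AddCommGroup N]
    [Module R N] where
  /-- the ranks of the free modules -/
  rank : ℕ → ℕ
  /-- the differentials -/
  d : ∀ i, Matrix (Fin (rank i)) (Fin (rank (i + 1))) R
  /-- the augmentation -/
  π : (Fin (rank 0) → R) →ₗ[R] N
  surjective : Surjective π
  exact_zero : Exact ((d 0).coeffMap R) π
  exact_succ : ∀ i, Exact ((d (i + 1)).coeffMap R) ((d i).coeffMap R)

namespace MatrixResolution

variable {R : Type u} [CommRing R] {N : Type u} [AddCommGroup N] [Module R N]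

lemma exists_range_coeffMap_eq [IsNoetherianRing R] {k : ℕ} (K : Submodule R (Fin k → R)) :
    ∃ (m : ℕ) (B : Matrix (Fin k) (Fin m) R), LinearMap.range (B.coeffMap R) = K := by
  obtain ⟨m, f, hf⟩ := Module.Finite.exists_fin' R K
  refine ⟨m, LinearMap.toMatrix' (K.subtype ∘ₗ f), ?_⟩
  have : (LinearMap.toMatrix' (K.subtype ∘ₗ f)).coeffMap R = K.subtype ∘ₗ f := by
    rw [← Matrix.toLin'_toMatrix' (K.subtype ∘ₗ f)]
    ext
    simp [Matrix.coeffMap_apply, Pi.single_apply]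
  rw [this, LinearMap.range_comp, LinearMap.range_eq_top.mpr hf, Submodule.map_top,
    Submodule.range_subtype]

/-- Over a Noetherian ring every presentation extends to a resolution. -/
theorem exists_extending [IsNoetherianRing R] {k : ℕ} {π : (Fin k → R) →ₗ[R] N}
    (hπ : Surjective π) :
    ∃ (P : MatrixResolution R N) (e : (Fin k → R) ≃ₗ[R] (Fin (P.rank 0) → R)),
      P.π ∘ₗ e = π := by
  choose m B hB using fun k K ↦ exists_range_coeffMap_eq (R := R) (k := k) K
  -- the successive syzygies, each as a submodule of a free module
  let s : ℕ → Σ k, Submodule R (Fin k → R) := fun i ↦ Nat.rec ⟨k, LinearMap.ker π⟩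
    (fun _ t ↦ ⟨m t.1 t.2, LinearMap.ker ((B t.1 t.2).coeffMap R)⟩) i
  refine ⟨{ rank := fun i ↦ (s i).1
            d := fun i ↦ B (s i).1 (s i).2
            π := π
            surjective := hπ
            exact_zero := LinearMap.exact_iff.mpr (hB _ _).symm
            exact_succ := fun i ↦ LinearMap.exact_iff.mpr (hB _ _).symm },
    LinearEquiv.refl R _, rfl⟩

variable (P : MatrixResolution R N)

/-- The complex underlying a resolution. -/
noncomputable def complex : ChainComplex (ModuleCat.{u} R) ℕ :=
  ChainComplex.of (fun i ↦ ModuleCat.of R (Fin (P.rank i) → R))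
    (fun i ↦ ModuleCat.ofHom ((P.d i).coeffMap R)) fun i ↦ by
      rw [← ModuleCat.ofHom_comp, (P.exact_succ i).linearMap_comp_eq_zero]
      rfl

lemma complex_d (i : ℕ) :
    P.complex.d (i + 1) i = ModuleCat.ofHom ((P.d i).coeffMap R) :=
  ChainComplex.of_d (fun i ↦ ModuleCat.of R (Fin (P.rank i) → R))
    (fun i ↦ ModuleCat.ofHom ((P.d i).coeffMap R)) i

lemma complex_exactAt_succ (i : ℕ) : P.complex.ExactAt (i + 1) := by
  rw [HomologicalComplex.exactAt_iff' _ (i + 1 + 1) (i + 1) i (by simp) (by simp),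
    ShortComplex.ShortExact.moduleCat_exact_iff_function_exact]
  change Exact (P.complex.d _ _) (P.complex.d _ _)
  rw [complex_d, complex_d]
  exact P.exact_succ i

/-- The augmentation as a map of complexes. -/
noncomputable def augmentation :
    P.complex ⟶ (ChainComplex.single₀ (ModuleCat.{u} R)).obj (ModuleCat.of R N) :=
  (ChainComplex.toSingle₀Equiv _ _).symm ⟨ModuleCat.ofHom P.π, by
    rw [complex_d]
    exact ModuleCat.hom_ext P.exact_zero.linearMap_comp_eq_zero⟩

lemma augmentation_f_zero : P.augmentation.f 0 = ModuleCat.ofHom P.π :=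
  ChainComplex.toSingle₀Equiv_symm_apply_f_zero ..

instance : QuasiIso P.augmentation where
  quasiIsoAt n := by
    cases n with
    | zero =>
      rw [ChainComplex.quasiIsoAt₀_iff, ShortComplex.quasiIso_iff_of_zeros' _ rfl rfl rfl]
      refine ⟨(ShortComplex.ShortExact.moduleCat_exact_iff_function_exact _).mpr ?_,
        (ModuleCat.epi_iff_surjective _).mpr ?_⟩
      · change Exact (P.complex.d 1 0) (P.augmentation.f 0)
        rw [complex_d, augmentation_f_zero]
        exact P.exact_zero
      · change Surjective (P.augmentation.f 0)
        rw [augmentation_f_zero]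
        exact P.surjective
    | succ n =>
      rw [quasiIsoAt_iff_exactAt' _ _ (ChainComplex.exactAt_succ_single_obj _ _)]
      exact P.complex_exactAt_succ n

/-- The projective resolution underlying a resolution by matrices. -/
noncomputable def projectiveResolution : ProjectiveResolution (ModuleCat.of R N) where
  complex := P.complex
  projective i := inferInstanceAs
    (CategoryTheory.Projective (ModuleCat.of R (Fin (P.rank i) → R)))
  π := P.augmentation

/-- The identification `M ⊗ R ^ n = M ^ n` turns `M ⊗ A` into the action of `A` on `M ^ n`. -/
lemma piScalarRight_lTensor_coeffMap {m n : ℕ} (A : Matrix (Fin m) (Fin n) R) (M : Type u)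
    [AddCommGroup M] [Module R M] (z : M ⊗[R] (Fin n → R)) :
    TensorProduct.piScalarRight R R M (Fin m) ((A.coeffMap R).lTensor M z) =
      A.coeffMap M (TensorProduct.piScalarRight R R M (Fin n) z) := by
  induction z with
  | zero => simp
  | add x y hx hy => simp only [map_add, hx, hy]
  | tmul y w =>
    simp only [LinearMap.lTensor_tmul, TensorProduct.piScalarRight_apply,
      TensorProduct.piScalarRightHom_tmul]
    exact (A.coeffMap_smul_right w y).symm

lemma exact_lTensor_coeffMap_iff {l m n : ℕ} (A : Matrix (Fin l) (Fin m) R)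
    (B : Matrix (Fin m) (Fin n) R) (M : Type u) [AddCommGroup M] [Module R M] :
    Exact ((B.coeffMap R).lTensor M) ((A.coeffMap R).lTensor M) ↔
      Exact (B.coeffMap M) (A.coeffMap M) :=
  (Function.Exact.iff_of_ladder_linearEquiv (e₁ := TensorProduct.piScalarRight R R M (Fin n))
    (e₂ := TensorProduct.piScalarRight R R M (Fin m))
    (e₃ := TensorProduct.piScalarRight R R M (Fin l))
    (LinearMap.ext fun z ↦ (piScalarRight_lTensor_coeffMap B M z).symm)
    (LinearMap.ext fun z ↦ (piScalarRight_lTensor_coeffMap A M z).symm)).symm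

/-- `Tor` is computed by a resolution by matrices with coefficients in `M`. -/
theorem isZero_tor_succ_iff (M : Type u) [AddCommGroup M] [Module R M] (i : ℕ) :
    Limits.IsZero (((Tor (ModuleCat.{u} R) (i + 1)).obj (ModuleCat.of R M)).obj
      (ModuleCat.of R N)) ↔
      Exact ((P.d (i + 1)).coeffMap M) ((P.d i).coeffMap M) := by
  let F := (MonoidalCategory.tensoringLeft (ModuleCat.{u} R)).obj (ModuleCat.of R M)
  rw [← exact_lTensor_coeffMap_iff]
  refine (P.projectiveResolution.isoLeftDerivedObj F (i + 1)).isZero_iff.trans ?_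
  refine (HomologicalComplex.exactAt_iff_isZero_homology _ _).symm.trans ?_
  rw [HomologicalComplex.exactAt_iff' _ (i + 1 + 1) (i + 1) i (by simp) (by simp),
    ShortComplex.ShortExact.moduleCat_exact_iff_function_exact]
  change Exact (F.map (P.complex.d _ _)) (F.map (P.complex.d _ _)) ↔ _
  rw [complex_d, complex_d]
  rfl

end MatrixResolution

/-! ### The depth of `M ⊗ N` -/

/-- The supremum defining the depth is attained up to any finite bound. -/
lemma hasDepthGE_of_le_moduleDepth {R : Type*} [CommRing R] [IsLocalRing R]
    {M : Type*} [AddCommGroup M] [Module R M] {n : ℕ} (h : n ≤ moduleDepth R M) :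
    HasDepthGE R M n := by
  cases n with
  | zero => exact .zero
  | succ n =>
    have hlt : (n : ℕ∞) < moduleDepth R M := lt_of_lt_of_le (by exact_mod_cast n.lt_succ_self) h
    simp only [moduleDepth, lt_iSup_iff] at hlt
    obtain ⟨rs, hrs, hreg, hlen⟩ := hlt
    have hlen' : n < rs.length := by exact_mod_cast hlen
    refine ⟨rs.take (n + 1), by simpa using hlen', fun r hr ↦ hrs r (List.mem_of_mem_take hr), ?_⟩
    rw [← List.take_append_drop (n + 1) rs, isWeaklyRegular_append_iff] at hreg
    exact hreg.1

lemma IsMaximalCohenMacaulay.hasDepthGE {R : Type*} [CommRing R] [IsLocalRing R] {M : Type*}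
    [AddCommGroup M] [Module R M] (h : IsMaximalCohenMacaulay R M) {d : ℕ}
    (hd : ringKrullDim R = d) : HasDepthGE R M d := by
  have h1 : moduleDepth R M = d := by
    have := h.depth_eq
    rw [hd] at this
    exact_mod_cast this
  exact hasDepthGE_of_le_moduleDepth h1.ge

/-- If the first syzygy of `C` in a resolution stays a submodule after tensoring with `M`, then
`Tor₁(M, C) = 0`. -/
lemma MatrixResolution.exact_coeffMap_one {R : Type u} [CommRing R] {N C : Type u}
    [AddCommGroup N] [Module R N] [AddCommGroup C] [Module R C] (P : MatrixResolution R C)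
    {ι : N →ₗ[R] (Fin (P.rank 0) → R)} (hι : Injective ι) (hιπ : Exact ι P.π) (M : Type u)
    [AddCommGroup M] [Module R M] (hM : Injective (ι.lTensor M)) :
    Exact ((P.d 1).coeffMap M) ((P.d 0).coeffMap M) := by
  rw [← exact_lTensor_coeffMap_iff]
  have hmem : ∀ w, (P.d 0).coeffMap R w ∈ LinearMap.range ι := fun w ↦
    (hιπ _).mp (P.exact_zero.apply_apply_eq_zero w)
  let ρ : (Fin (P.rank 1) → R) →ₗ[R] N :=
    (LinearEquiv.ofInjective ι hι).symm.toLinearMap ∘ₗ ((P.d 0).coeffMap R).codRestrict _ hmem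
  have hιρ : ι ∘ₗ ρ = (P.d 0).coeffMap R := by
    refine LinearMap.ext fun w ↦ ?_
    exact congrArg Subtype.val ((LinearEquiv.ofInjective ι hι).apply_symm_apply ⟨_, hmem w⟩)
  have hρ : Surjective ρ := fun y ↦ by
    obtain ⟨w, hw⟩ := (P.exact_zero (ι y)).mp (hιπ.apply_apply_eq_zero y)
    exact ⟨w, hι (by rw [← hw, ← hιρ]; rfl)⟩
  have hex : Exact ((P.d 1).coeffMap R) ρ := by
    have := P.exact_succ 0
    rw [← hιρ] at this
    exact (Function.Injective.comp_exact_iff_exact hι).mp this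
  rw [← hιρ, LinearMap.lTensor_comp]
  exact (Function.Injective.comp_exact_iff_exact hM).mpr (lTensor_exact M hex hρ)

theorem mainTheorem12 (R : Type u) [CommRing R] [IsLocalRing R] [IsNoetherianRing R]
    (hR : IsHypersurface R) (hsing : HasIsolatedSingularity R)
    (M : Type u) [AddCommGroup M] [Module R M] (N : Type u) [AddCommGroup N] [Module R N]
    (hM : IsMaximalCohenMacaulay R M) (hN : IsMaximalCohenMacaulay R N)
    (hMfree : ¬ Module.Free R M) (hNfree : ¬ Module.Free R N)
    (hrigid : IsTorRigid R M) :
    moduleDepth R (M ⊗[R] N) = 0 := by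
  -- nonzero depth gives a regular element, also when the depth is infinite
  by_contra hdepth
  obtain ⟨d, hd⟩ := exists_nat_ringKrullDim R
  have h := hR.isCohenMacaulayAlmostRegular hd
  have := hM.finite
  have := hN.finite
  have hMd := hM.hasDepthGE hd
  have hNd := hN.hasDepthGE hd
  obtain ⟨x, hx, hreg⟩ : ∃ x ∈ maximalIdeal R, IsSMulRegular (M ⊗[R] N) x := by
    obtain ⟨x, hx, hreg, -⟩ := (hasDepthGE_of_le_moduleDepth (n := 1)
      (Order.one_le_iff_ne_zero.mpr hdepth)).exists_cons
    exact ⟨x, hx, hreg⟩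
  obtain ⟨k, ι₀, hι₀, hC⟩ := h.exists_embedding hNd
  obtain ⟨P, e, he⟩ := MatrixResolution.exists_extending
    (Submodule.mkQ_surjective (LinearMap.range ι₀))
  -- the embedding of `N`, seen in the first module of a resolution of its cokernel
  let ι := e.toLinearMap ∘ₗ ι₀
  have hι : Injective ι := e.injective.comp hι₀
  have hιπ : Exact ι P.π := by
    have hex := LinearMap.exact_map_mkQ_range ι₀
    rw [← he] at hex
    intro w
    obtain ⟨v, rfl⟩ := e.surjective w
    simpa [ι] using hex v
  have hproj : ∀ (p : Ideal R) [p.IsPrime], p ≠ maximalIdeal R → Module.Projective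
      (Localization.AtPrime p) (LocalizedModule p.primeCompl ((Fin k → R) ⧸ LinearMap.range ι₀)) := by
    intro p _ hp
    have := hsing p hp
    obtain ⟨n, hn⟩ := exists_nat_ringKrullDim (Localization.AtPrime p)
    have := IsSyzygy.free_of_isRegularLocalRing hn ((h.isSyzygy n hC).localizedModule p.primeCompl)
    infer_instance
  have hinj := lTensor_injective_of_isSMulRegular M hι hιπ P.surjective hproj hx hreg
  have hexact : ∀ i, Exact ((P.d (i + 1)).coeffMap M) ((P.d i).coeffMap M) := fun i ↦
    (P.isZero_tor_succ_iff M i).mp <| hrigid _ 1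
      ((P.isZero_tor_succ_iff M 0).mpr (P.exact_coeffMap_one hι hιπ M hinj)) (i + 1) (by lia)
  rcases h.free_or_free hMd hC P.rank P.d P.surjective P.exact_zero
    (fun i _ ↦ P.exact_succ i) (fun i _ ↦ hexact i) with hfree | hfree
  · exact hMfree hfree
  · -- a free cokernel splits off
    refine hNfree ?_
    obtain ⟨σ, hσ⟩ := Module.projective_lifting_property P.π LinearMap.id P.surjective
    have htfae := (hιπ.split_tfae hι P.surjective).out 0 1
    obtain ⟨l, hl⟩ := htfae.mp ⟨σ, hσ⟩
    have := Module.Projective.of_split ι l hl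
    exact Module.free_of_flat_of_isLocalRing
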